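/- Let $\mathrm{Hotab}$ be the localization of the category of non-negatively graded chain complexes of abelian groups at the quasi-isomorphisms. For a small category $A$ let $\mathrm{Ab}(A)$ be the category of functors $A^{op}\to\mathsf{Ab}$ (abelian presheaves on $A$), and let $H_A:\mathrm{Ab}(A)\to\mathrm{Hotab}$ be the homology functor, i.e. the left derived functor of the colimit functor: $H_A(X)$ is the homotopy colimit of $X$ (viewed in degree $0$), computed as $\operatorname{colim}_{A^{op}}P_\bullet$ for a projective resolution $P_\bullet\to X$. A morphism $f$ of $\mathrm{Ab}(A)$ is a weak equivalence, $f\in\mathcal W^{ab}_A$, if $H_A(f)$ is an isomorphism. For a functor $u:A\to B$ between small categories let $u^*:\mathrm{Ab}(B)\to\mathrm{Ab}(A)$, $X\mapsto X\circ u^{op}$, be the restriction functor. For $X$ in $\mathrm{Ab}(B)$ there is a canonical morphism $H_A(u^*X)\to H_B(X)$ in $\mathrm{Hotab}$, induced by the canonical maps $\operatorname{colim}_{A^{op}}u^*Y\to\operatorname{colim}_{B^{op}}Y$. Taking for $X$ the constant presheaf with value $\mathbb Z$, one gets $H(u,\mathbb Z):H(A,\mathbb Z)\to H(B,\mathbb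 Z)$; let $\mathcal W^{ab}_\infty$ be the class of those functors $u$ between small categories for which $H(u,\mathbb Z)$ is an isomorphism. For an object $b$ of $B$ let $A/b$ be the category of pairs $(a,\,u(a)\to b)$ and let $u/b:A/b\to B/b$ be the functor $(a,u(a)\to b)\mapsto(u(a),u(a)\to b)$. The functor $u$ is $\mathcal W^{ab}_\infty$-aspherical if $u/b\in\mathcal W^{ab}_\infty$ for every object $b$ of $B$. Let $\lambda_{u,b}$ be the chain map induced by $u/b$ from the unnormalized integral chain complex of the nerve of $A/b$ to that of the nerve of $B/b$. For an abelian presheaf $X$ on $B$ let $$\lambda_{u,X}:\ \bigoplus_{\varphi:[n]\to A}X(u\varphi(n))\ \longrightarrow\ \bigoplus_{\psi:[n]\to B}X(\psi(n)),\qquad \langle\varphi,x\rangle\mapsto\langle u\circ\varphi,x\rangle \qquad (n\ge 0)$$ be the comparison map between the Bousfield–Kan complexes of $u^*X$ and $X$. Here, for $Y$ in $\mathrm{Ab}(C)$, the Bousfield–Kan complex of $Y$ is $\bigoplus_{\varphi:[n]\to C}Y(\varphi(n))$ in degree $n$, with differential $d\langle\varphi,x\rangle=\sum_{i=0}^{n}(-1)^i\langle\varphi\circ\delta_i,\,x_i\rangle$,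 where $\delta_i:[n-1]\to[n]$ is the $i$-th coface and $x_i$ is the image of $x$ under the map $Y(\varphi(n))\to Y(\varphi(\delta_i(n-1)))$. **Proposition.** Let $u:A\to B$ be a functor between small categories. The following conditions are equivalent: 1. $u$ is $\mathcal W^{ab}_\infty$-aspherical; 2. for every object $b$ of $B$, the morphism $\lambda_{u,b}$ is a quasi-isomorphism; 3. for every abelian presheaf $X$ on $B$, the morphism $\lambda_{u,X}$ is a quasi-isomorphism; 4. there is a natural isomorphism $H_A\circ u^*\simeq H_B$ of functors $\mathrm{Ab}(B)\to\mathrm{Hotab}$. Moreover, these conditions imply: for every morphism $f$ of abelian presheaves on $B$, one has $f\in\mathcal W^{ab}_B$ if and only if $u^*f\in\mathcal W^{ab}_A$. -/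

import Mathlib

open CategoryTheory Category Limits Opposite Simplicial

universe u

noncomputable section

namespace HomAsph

/-- The category of abelian presheaves on a small category. -/
abbrev AbPsh (A : Type u) [SmallCategory A] := Aᵒᵖ ⥤ AddCommGrpCat.{u}

/-- The restriction functor on abelian presheaves along `F : A ⥤ B`, i.e. precomposition
with `F.op`. -/
abbrev restr {A B : Type u} [SmallCategory A] [SmallCategory B] (F : A ⥤ B) :
    AbPsh B ⥤ AbPsh A :=
  (Functor.whiskeringLeft Aᵒᵖ Bᵒᵖ AddCommGrpCat.{u}).obj F.op

/-! ### Abelian presheaves have enough projectives -/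

section EnoughProjectives

variable (A : Type u) [SmallCategory A]

/-- The abelian presheaf freely generated by the presheaf represented by `a`. -/
abbrev freeRep (a : A) : AbPsh A := yoneda.obj a ⋙ AddCommGrpCat.free

/-- The morphism from `freeRep A a` determined by an element of `X a`. -/
def freeRepHom {a : A} {X : AbPsh A} (x : X.obj (op a)) : freeRep A a ⟶ X :=
  ((AddCommGrpCat.adj.whiskerRight Aᵒᵖ).homEquiv (yoneda.obj a) X).symm
    (yonedaEquiv.symm x)

instance projective_freeRep (a : A) : Projective (freeRep A a) := by
  have h : Projective (yoneda.obj a) := by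
    constructor
    intro E X f e he
    have hs : Function.Surjective (e.app (op a)) := by
      rw [← CategoryTheory.epi_iff_surjective]
      infer_instance
    obtain ⟨y, hy⟩ := hs (yonedaEquiv f)
    refine ⟨yonedaEquiv.symm y, yonedaEquiv.injective ?_⟩
    rw [yonedaEquiv_comp, Equiv.apply_symm_apply, hy]
  have hp : ((Functor.whiskeringRight Aᵒᵖ _ _).obj
      (forget AddCommGrpCat.{u})).PreservesEpimorphisms := by
    constructor
    intro X Y f hf
    have (c : Aᵒᵖ) : Epi ((((Functor.whiskeringRight Aᵒᵖ _ _).obj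
        (forget AddCommGrpCat.{u})).map f).app c) := by
      dsimp
      infer_instance
    exact NatTrans.epi_of_epi_app _
  exact (AddCommGrpCat.adj.whiskerRight Aᵒᵖ).map_projective _ h

lemma exists_freeRepHom {a : A} {X : AbPsh A} (x : X.obj (op a)) :
    ∃ y, (freeRepHom A x).app (op a) y = x := by
  have h : ((AddCommGrpCat.adj.whiskerRight Aᵒᵖ).homEquiv (yoneda.obj a) X)
      (freeRepHom A x) = yonedaEquiv.symm x := by simp [freeRepHom]
  have h2 := congrArg (fun t => yonedaEquiv t) h
  simp only [Equiv.apply_symm_apply] at h2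
  rw [Adjunction.homEquiv_unit] at h2
  exact ⟨_, h2⟩

instance enoughProjectives_abPsh : EnoughProjectives (AbPsh A) where
  presentation X := by
    let P : AbPsh A := ∐ fun s : (Σ a : A, X.obj (op a)) => freeRep A s.1
    let f : P ⟶ X := Sigma.desc fun s => freeRepHom A s.2
    have (c : Aᵒᵖ) : Epi (f.app c) := by
      rw [AddCommGrpCat.epi_iff_surjective]
      intro x
      obtain ⟨y, hy⟩ := exists_freeRepHom A (a := c.unop) (X := X) x
      refine ⟨(Sigma.ι (fun s : (Σ a : A, X.obj (op a)) => freeRep A s.1)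
        ⟨c.unop, x⟩).app c y, ?_⟩
      have hc := congrArg (fun t => t.app c) (Sigma.ι_desc
        (fun s : (Σ a : A, X.obj (op a)) => freeRepHom A s.2) ⟨c.unop, x⟩)
      exact (ConcreteCategory.congr_hom hc y).trans hy
    exact ⟨{ p := P, f := f, epi := NatTrans.epi_of_epi_app f }⟩

end EnoughProjectives

/-! ### The homology functor -/

instance hasLocalization_quasiIso :
    (HomologicalComplex.quasiIso AddCommGrpCat.{u} (ComplexShape.down ℕ)).HasLocalization :=
  MorphismProperty.HasLocalization.standard _

instance qFactorsThroughHomotopy_down :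
    (ComplexShape.down ℕ).QFactorsThroughHomotopy AddCommGrpCat.{u} :=
  ComplexShape.QFactorsThroughHomotopy_of_exists_prev _ (fun j => ⟨j + 1, by simp⟩) _

/-- The non-negative derived category of abelian groups: the localization of non-negatively
graded chain complexes of abelian groups at the quasi-isomorphisms. -/
abbrev Hotab := HomologicalComplexUpToQuasiIso AddCommGrpCat.{u} (ComplexShape.down ℕ)

/-- The colimit functor on abelian presheaves. -/
abbrev colimA (A : Type u) [SmallCategory A] : AbPsh A ⥤ AddCommGrpCat.{u} := colim

/-- The homology functor of `A`: the left derived functor of the colimit functor, with values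
in the derived category. It sends `X` to the homotopy colimit of `X`, placed in degree `0`,
i.e. to the colimit of a projective resolution of `X`. -/
def homologyFun (A : Type u) [SmallCategory A] : AbPsh A ⥤ Hotab.{u} :=
  (colimA A).leftDerivedToHomotopyCategory ⋙ HomologicalComplexUpToQuasiIso.Qh

section Canonical

variable {A B : Type u} [SmallCategory A] [SmallCategory B] (F : A ⥤ B)

/-- A projective resolution of `F^* X` maps to the restriction of a resolution of `X`,
compatibly with the augmentations. -/
lemma exists_lift (X : AbPsh B) (P : ProjectiveResolution ((restr F).obj X))
    (Q : ProjectiveResolution X) :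
    ∃ f : P.complex ⟶ ((restr F).mapHomologicalComplex _).obj Q.complex,
      f.f 0 ≫ (restr F).map (Q.π.f 0) = P.π.f 0 := by
  have e0 := Q.exact₀.map (restr F)
  have e (n : ℕ) := (Q.exact_succ n).map (restr F)
  let p : P.complex.X 0 ⟶ (restr F).obj X := P.π.f 0
  let q : (restr F).obj (Q.complex.X 0) ⟶ (restr F).obj X := (restr F).map (Q.π.f 0)
  have hepi : Epi q := (restr F).map_epi (Q.π.f 0)
  let f0 : P.complex.X 0 ⟶ (restr F).obj (Q.complex.X 0) := Projective.factorThru p q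
  have h0 : f0 ≫ (restr F).map (Q.π.f 0) = P.π.f 0 := Projective.factorThru_comp p q
  have h0' : (P.complex.d 1 0 ≫ f0) ≫ (restr F).map (Q.π.f 0) = 0 := by
    rw [Category.assoc, h0]
    exact P.complex_d_comp_π_f_zero
  let f1 : P.complex.X 1 ⟶ (restr F).obj (Q.complex.X 1) :=
    e0.liftFromProjective (P.complex.d 1 0 ≫ f0) h0'
  have h1 : f1 ≫ (restr F).map (Q.complex.d 1 0) = P.complex.d 1 0 ≫ f0 :=
    e0.liftFromProjective_comp _ _
  have h2 (n : ℕ) (g : P.complex.X n ⟶ (restr F).obj (Q.complex.X n))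
      (g' : P.complex.X (n + 1) ⟶ (restr F).obj (Q.complex.X (n + 1)))
      (hg : g' ≫ (restr F).map (Q.complex.d (n + 1) n) = P.complex.d (n + 1) n ≫ g) :
      (P.complex.d (n + 2) (n + 1) ≫ g') ≫ (restr F).map (Q.complex.d (n + 1) n) = 0 := by
    rw [Category.assoc, hg, ← Category.assoc, HomologicalComplex.d_comp_d, zero_comp]
  exact ⟨ChainComplex.mkHom P.complex (((restr F).mapHomologicalComplex _).obj Q.complex)
    f0 f1 h1 (fun n g => ⟨(e n).liftFromProjective (P.complex.d (n + 2) (n + 1) ≫ g.2.1)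
      (h2 n g.1 g.2.1 g.2.2), (e n).liftFromProjective_comp _ _⟩), h0⟩

/-- The comparison map `colim F^* Y ⟶ colim Y`, natural in the abelian presheaf `Y`. -/
def colimRestr : restr F ⋙ colimA A ⟶ colimA B where
  app Y := colimit.pre Y F.op
  naturality Y Z f := by
    apply colimit.hom_ext
    intro j
    simp

/-- The canonical morphism `H(A, F^* X) ⟶ H(B, X)`: it is represented by the chain map
`colim P ⟶ colim F^* Q ⟶ colim Q`, where `P` and `Q` are projective resolutions of `F^* X`
and `X`, and `P ⟶ F^* Q` lifts the identity of `F^* X` (it is unique up to homotopy). -/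
def homologyRestr (X : AbPsh B) :
    (homologyFun A).obj ((restr F).obj X) ⟶ (homologyFun B).obj X :=
  let P := projectiveResolution ((restr F).obj X)
  let Q := projectiveResolution X
  HomologicalComplexUpToQuasiIso.Qh.map
    ((P.isoLeftDerivedToHomotopyCategoryObj (colimA A)).hom ≫
      (HomotopyCategory.quotient _ _).map
        (((colimA A).mapHomologicalComplex _).map (exists_lift F X P Q).choose ≫
          (NatTrans.mapHomologicalComplex (colimRestr F) _).app Q.complex) ≫
      (Q.isoLeftDerivedToHomotopyCategoryObj (colimA B)).inv)

end Canonical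

/-- The constant abelian presheaf with value `ℤ`. Its restriction along a functor is again
the constant presheaf with value `ℤ`. -/
def constZ (A : Type u) [SmallCategory A] : AbPsh A :=
  (Functor.const _).obj (AddCommGrpCat.of (ULift.{u} ℤ))

lemma restr_constZ {A B : Type u} [SmallCategory A] [SmallCategory B] (F : A ⥤ B) :
    (restr F).obj (constZ B) = constZ A := rfl

/-- The functors between small categories inducing an isomorphism in integral homology. -/
def IsHomologyEquiv {A B : Type u} [SmallCategory A] [SmallCategory B] (F : A ⥤ B) : Prop :=
  IsIso (homologyRestr F (constZ B))

/-- `F` is aspherical for the class of homology equivalences: for every `b`, the functor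
`A/b ⥤ B/b`, `(a, F a ⟶ b) ↦ (F a, F a ⟶ b)`, belongs to this class. -/
def IsHomologyAspherical {A B : Type u} [SmallCategory A] [SmallCategory B] (F : A ⥤ B) :
    Prop :=
  ∀ b : B, IsHomologyEquiv (CostructuredArrow.toOver F b)

/-- Weak equivalences of abelian presheaves. -/
def weakEq (A : Type u) [SmallCategory A] : MorphismProperty (AbPsh A) :=
  (MorphismProperty.isomorphisms Hotab.{u}).inverseImage (homologyFun A)

/-! ### Bousfield-Kan complexes -/

section BousfieldKan

/-- The restriction of a functor `φ : [n] ⥤ A` along `θ : [m] ⟶ [n]`; this is the action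
of `θ` on the nerve of `A`. -/
def pull {A : Type u} [SmallCategory A] {m n : SimplexCategory} (θ : m ⟶ n)
    (φ : ComposableArrows A n.len) : ComposableArrows A m.len :=
  φ.whiskerLeft θ.toOrderHom.monotone.functor

lemma pull_eq_nerve_map {A : Type u} [SmallCategory A] {m n : SimplexCategory} (θ : m ⟶ n)
    (φ : ComposableArrows A n.len) : pull θ φ = (nerve A).map θ.op φ := rfl

/-- The morphism `φ (θ m) ⟶ φ n`. -/
def pullRight {A : Type u} [SmallCategory A] {m n : SimplexCategory} (θ : m ⟶ n)
    (φ : ComposableArrows A n.len) : (pull θ φ).right ⟶ φ.right :=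
  φ.map (homOfLE (Fin.le_last (θ.toOrderHom (Fin.last _))))

/-- The inclusion of the summand `X (φ n)` in `⨁_{φ : [n] ⥤ A} X (φ n)`. -/
abbrev replι {A : Type u} [SmallCategory A] (X : AbPsh A) {n : ℕ} (φ : ComposableArrows A n) :
    X.obj (op φ.right) ⟶ ∐ fun ψ : ComposableArrows A n => X.obj (op ψ.right) :=
  Sigma.ι (fun ψ : ComposableArrows A n => X.obj (op ψ.right)) φ

/-- The simplicial replacement of an abelian presheaf `X`: in degree `n` it is the direct sum,
over the functors `φ : [n] ⥤ A`, of the groups `X (φ n)`. -/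
def simplicialRepl {A : Type u} [SmallCategory A] (X : AbPsh A) :
    SimplicialObject AddCommGrpCat.{u} where
  obj n := ∐ fun φ : ComposableArrows A n.unop.len => X.obj (op φ.right)
  map θ := Sigma.desc fun φ => X.map (pullRight θ.unop φ).op ≫ replι X (pull θ.unop φ)
  map_id n := by
    apply Sigma.hom_ext
    intro φ
    rw [Sigma.ι_desc, comp_id]
    have h : pullRight (𝟙 n.unop) φ = 𝟙 φ.right := φ.map_id _
    refine Eq.trans (congrArg (fun t => X.map (Quiver.Hom.op t) ≫ replι X φ) h) ?_
    rw [op_id, X.map_id, id_comp]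
  map_comp {n m k} θ θ' := by
    apply Sigma.hom_ext
    intro φ
    have h : pullRight (θ'.unop ≫ θ.unop) φ =
        pullRight θ'.unop (pull θ.unop φ) ≫ pullRight θ.unop φ := φ.map_comp _ _
    rw [Sigma.ι_desc, Sigma.ι_desc_assoc, assoc, Sigma.ι_desc, ← X.map_comp_assoc, ← op_comp]
    exact congrArg (fun t => X.map (Quiver.Hom.op t) ≫
      replι X (pull θ'.unop (pull θ.unop φ))) h

/-- The Bousfield-Kan complex of `X`: the unnormalized chain complex of the simplicial
replacement, with differential the alternating sum of the faces. -/
def bkComplex {A : Type u} [SmallCategory A] (X : AbPsh A) : ChainComplex AddCommGrpCat.{u} ℕ :=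
  (AlgebraicTopology.alternatingFaceMapComplex _).obj (simplicialRepl X)

variable {A B : Type u} [SmallCategory A] [SmallCategory B] (F : A ⥤ B)

/-- The map of simplicial replacements `⟨φ, x⟩ ↦ ⟨F ∘ φ, x⟩`. -/
def simplicialReplMap (X : AbPsh B) :
    simplicialRepl ((restr F).obj X) ⟶ simplicialRepl X where
  app n := Sigma.desc fun φ : ComposableArrows A n.unop.len =>
    replι X ((F.mapComposableArrows _).obj φ)
  naturality n m θ := by
    apply Sigma.hom_ext
    intro φ
    refine Eq.trans (b := X.map (F.map (pullRight θ.unop φ)).op ≫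
      replι X ((F.mapComposableArrows _).obj (pull θ.unop φ))) ?_ ?_
    · refine Eq.trans (Sigma.ι_desc_assoc _ _ _) ?_
      refine Eq.trans (assoc _ _ _) ?_
      exact congrArg (X.map (F.map (pullRight θ.unop φ)).op ≫ ·) (Sigma.ι_desc _ _)
    · refine Eq.symm (Eq.trans (Sigma.ι_desc_assoc _ _ _) ?_)
      exact Sigma.ι_desc _ _

/-- The comparison `⨁_{φ : [n] ⥤ A} X (F (φ n)) ⟶ ⨁_{ψ : [n] ⥤ B} X (ψ n)` of
Bousfield-Kan complexes, `⟨φ, x⟩ ↦ ⟨F ∘ φ, x⟩`. -/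
def lambdaPsh (X : AbPsh B) : bkComplex ((restr F).obj X) ⟶ bkComplex X :=
  (AlgebraicTopology.alternatingFaceMapComplex _).map (simplicialReplMap F X)

/-- The chain map from the unnormalized integral chains of the nerve of `A/b` to those of the
nerve of `B/b` induced by `A/b ⥤ B/b`. -/
def lambdaObj (b : B) :
    (nerve (CostructuredArrow F b)).chainComplex (AddCommGrpCat.of (ULift.{u} ℤ)) ⟶
      (nerve (Over b)).chainComplex (AddCommGrpCat.of (ULift.{u} ℤ)) :=
  SSet.chainComplexMap (nerveMap (CostructuredArrow.toOver F b)) _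

end BousfieldKan

end HomAsph

end

noncomputable section

namespace HomAsph

/-! ### Dimension shifting -/

section DimensionShifting

variable {C : Type*} [Category* C] [Abelian C]

/-! The Bousfield-Kan complex `bkFunctor` is an exact functor of the presheaf which preserves
coproducts, and its `H₀` is the colimit. On the free presheaf `ℤ[Hom(-, b)]` it is the chain complex
of the nerve of `B/b`, which has a terminal object, so it is acyclic in positive degrees there.
Acyclicity passes to coproducts and retracts, hence to all projectives (`exactAt_bk_of_projective`).

Dimension shifting along a resolution (`ExactTower.Realization.quasiIso_iff`) then shows that the
Bousfield-Kan complex computes the derived colimit. Instead of a double complex, it writes both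
homologies as the same kernel between `H₀` groups. The argument is natural for a lift `P ⟶ F^* Q`
between resolutions, so the canonical morphism `H_A(F^* X) ⟶ H_B(X)` is invertible exactly when
`lambdaPsh F X` is a quasi-isomorphism (`isIso_homologyRestr_iff`).

1 ⇔ 2 is this criterion for `A/b ⥤ B/b` and constant coefficients. For 2 ⇒ 3, the Bousfield-Kan
complex of `F^* ℤ[Hom(-, b)]` is the chain complex of the nerve of `A/b`, so condition 2 is
condition 3 for free presheaves (`quasiIso_lambdaPsh_freeRep_iff`). It extends to every `X` because
the restriction of a projective resolution then has acyclic terms with the same colimits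
(`quasiIso_lambdaPsh`). 3 ⇒ 4 holds since the canonical morphism is natural.

In 4 ⇒ 2 the given isomorphism need not be the canonical one (`quasiIso_lambdaPsh_freeRep_of_iso`).
For a free presheaf the higher homology vanishes on both sides, so only `H₀` matters. There the
target is cyclic: if `A/b` is nonempty the comparison is onto, and a surjective endomorphism of a
finitely generated group is injective; if `A/b` is empty both sides vanish. The statement on weak
equivalences follows from 4. -/

variable (C) in
/-- A sequence of short exact sequences `0 ⟶ K (n + 1) ⟶ E n ⟶ K n ⟶ 0` of chain complexes. -/
structure ExactTower where
  /-- the syzygies -/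
  K : ℕ → ChainComplex C ℕ
  /-- the terms of the resolution -/
  E : ℕ → ChainComplex C ℕ
  /-- the inclusion of a syzygy -/
  ι : ∀ n, K (n + 1) ⟶ E n
  /-- the projection on a syzygy -/
  π : ∀ n, E n ⟶ K n
  w : ∀ n, ι n ≫ π n = 0
  shortExact : ∀ n, (ShortComplex.mk _ _ (w n)).ShortExact

namespace ExactTower

/-- Forget the first short exact sequence. -/
abbrev shift (R : ExactTower C) : ExactTower C where
  K n := R.K (n + 1)
  E n := R.E (n + 1)
  ι n := R.ι (n + 1)
  π n := R.π (n + 1)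
  w n := R.w (n + 1)
  shortExact n := R.shortExact (n + 1)

/-- Morphisms of towers. -/
structure Hom (R R' : ExactTower C) where
  /-- the map on syzygies -/
  k : ∀ n, R.K n ⟶ R'.K n
  /-- the map on the terms of the resolution -/
  e : ∀ n, R.E n ⟶ R'.E n
  ι_comm : ∀ n, k (n + 1) ≫ R'.ι n = R.ι n ≫ e n
  π_comm : ∀ n, e n ≫ R'.π n = R.π n ≫ k n

/-- Forget the map on the first short exact sequences. -/
abbrev Hom.shift {R R' : ExactTower C} (f : Hom R R') : Hom R.shift R'.shift where
  k n := f.k (n + 1)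
  e n := f.e (n + 1)
  ι_comm n := f.ι_comm (n + 1)
  π_comm n := f.π_comm (n + 1)

/-- The connecting morphism of the first short exact sequence. -/
def δ (R : ExactTower C) (n : ℕ) : (R.K 0).homology (n + 1) ⟶ (R.K 1).homology n :=
  (R.shortExact 0).δ (n + 1) n (by simp)

lemma δ_naturality {R R' : ExactTower C} (f : Hom R R') (n : ℕ) :
    R.δ n ≫ HomologicalComplex.homologyMap (f.k 1) n =
      HomologicalComplex.homologyMap (f.k 0) (n + 1) ≫ R'.δ n :=
  HomologicalComplex.HomologySequence.δ_naturality
    (S₁ := ShortComplex.mk _ _ (R.w 0)) (S₂ := ShortComplex.mk _ _ (R'.w 0))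
    { τ₁ := f.k 1
      τ₂ := f.e 0
      τ₃ := f.k 0
      comm₁₂ := f.ι_comm 0
      comm₂₃ := f.π_comm 0 } (R.shortExact 0) (R'.shortExact 0) (n + 1) n (by simp)

lemma δ_comp (R : ExactTower C) (n : ℕ) :
    R.δ n ≫ HomologicalComplex.homologyMap (R.ι 0) n = 0 :=
  (R.shortExact 0).δ_comp (n + 1) n (by simp)

lemma δ_exact (R : ExactTower C) (n : ℕ) : (ShortComplex.mk _ _ (R.δ_comp n)).Exact :=
  (R.shortExact 0).homology_exact₁ (n + 1) n (by simp)

/-- The iterated connecting morphism. -/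
def edge (R : ExactTower C) (n : ℕ) : (R.K 0).homology n ⟶ (R.K n).homology 0 :=
  match n with
  | 0 => 𝟙 _
  | n + 1 => R.δ n ≫ edge R.shift n

lemma edge_zero (R : ExactTower C) : R.edge 0 = 𝟙 _ := rfl

lemma edge_succ (R : ExactTower C) (n : ℕ) : R.edge (n + 1) = R.δ n ≫ edge R.shift n := rfl

lemma edge_naturality {R R' : ExactTower C} (f : Hom R R') (n : ℕ) :
    HomologicalComplex.homologyMap (f.k 0) n ≫ R'.edge n =
      R.edge n ≫ HomologicalComplex.homologyMap (f.k n) 0 := by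
  induction n generalizing R R' with
  | zero => simp [edge_zero]
  | succ n ih =>
    have h := ih f.shift
    dsimp only at h
    rw [edge_succ, edge_succ, assoc, ← h, ← assoc, ← assoc, δ_naturality]

/-- All the terms are exact in positive degrees. -/
def IsAcyclic (R : ExactTower C) : Prop :=
  ∀ i n : ℕ, IsZero ((R.E i).homology (n + 1))

lemma IsAcyclic.shift {R : ExactTower C} (h : R.IsAcyclic) : R.shift.IsAcyclic :=
  fun i n => h (i + 1) n

lemma IsAcyclic.mono_δ {R : ExactTower C} (h : R.IsAcyclic) (n : ℕ) : Mono (R.δ n) :=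
  (R.shortExact 0).mono_δ (n + 1) n (by simp) (h 0 n)

/-- Both neighbours in the long exact sequence are homology of `E 0` in positive degrees. For `R.δ
0` one neighbour is `H₀` of `E 0`, which need not vanish, and only injectivity survives. -/
lemma IsAcyclic.isIso_δ {R : ExactTower C} (h : R.IsAcyclic) (n : ℕ) : IsIso (R.δ (n + 1)) :=
  (R.shortExact 0).isIso_δ (n + 2) (n + 1) (by simp) (h 0 (n + 1)) (h 0 n)

lemma edge_comp (R : ExactTower C) (n : ℕ) :
    R.edge (n + 1) ≫ HomologicalComplex.homologyMap (R.ι n) 0 = 0 := by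
  induction n generalizing R with
  | zero => simp [edge_succ, edge_zero, δ_comp]
  | succ n ih =>
    have h := ih R.shift
    dsimp only at h
    rw [edge_succ, assoc, h, comp_zero]

lemma IsAcyclic.mono_edge {R : ExactTower C} (h : R.IsAcyclic) (n : ℕ) : Mono (R.edge n) := by
  induction n generalizing R with
  | zero => rw [edge_zero]; infer_instance
  | succ n ih =>
    rw [edge_succ]
    have := h.mono_δ n
    have := ih h.shift
    exact mono_comp _ _

/-- All the connecting morphisms composing the edge are isomorphisms except the last, whose image is
the kernel of `H₀(K (n + 1)) ⟶ H₀(E n)` by the long exact sequence. -/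
lemma IsAcyclic.edge_exact {R : ExactTower C} (h : R.IsAcyclic) (n : ℕ) :
    (ShortComplex.mk _ _ (R.edge_comp n)).Exact := by
  induction n generalizing R with
  | zero =>
    refine ShortComplex.exact_of_iso ?_ (R.δ_exact 0)
    exact ShortComplex.isoMk (Iso.refl _) (Iso.refl _) (Iso.refl _)
      (by simp [edge_succ, edge_zero]) (by simp)
  | succ n ih =>
    have := h.isIso_δ n
    refine ShortComplex.exact_of_iso ?_ (ih h.shift)
    exact ShortComplex.isoMk (asIso (R.δ (n + 1))).symm
      (Iso.refl _) (Iso.refl _) (by simp [edge_succ R (n + 1)]) (by simp)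

lemma homologyMap_ι_π (R : ExactTower C) (n : ℕ) :
    HomologicalComplex.homologyMap (R.ι n) 0 ≫ HomologicalComplex.homologyMap (R.π n) 0 = 0 := by
  rw [← HomologicalComplex.homologyMap_comp, R.w, HomologicalComplex.homologyMap_zero]

/-- The right exact sequence obtained by applying `H₀`. -/
lemma homology_zero_exact (R : ExactTower C) (n : ℕ) :
    (ShortComplex.mk _ _ (R.homologyMap_ι_π n)).Exact :=
  (R.shortExact n).homology_exact₂ 0

instance epi_homologyMap_π (R : ExactTower C) (n : ℕ) :
    Epi (HomologicalComplex.homologyMap (R.π n) 0) := by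
  have : Epi (R.π n) := (R.shortExact n).epi_g
  exact HomologicalComplex.epi_homologyMap_of_epi_of_not_rel _ 0 (by simp)

/-- A presentation of the complex obtained by applying `H₀` to the terms of a tower. -/
structure Realization (R : ExactTower C) where
  /-- the complex -/
  L : ChainComplex C ℕ
  /-- the identification of the terms of the complex -/
  a : ∀ n, L.X n ≅ (R.E n).homology 0
  comm : ∀ n, L.d (n + 1) n ≫ (a n).hom = (a (n + 1)).hom ≫
    HomologicalComplex.homologyMap (R.π (n + 1)) 0 ≫ HomologicalComplex.homologyMap (R.ι n) 0

namespace Realization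

variable {R : ExactTower C} (ρ : R.Realization)

/-- The projection of the terms of the complex on `H₀` of the syzygies. -/
def p (n : ℕ) : ρ.L.X n ⟶ (R.K n).homology 0 :=
  (ρ.a n).hom ≫ HomologicalComplex.homologyMap (R.π n) 0

instance (n : ℕ) : Epi (ρ.p n) := epi_comp _ _

lemma d_comp_a (n : ℕ) : ρ.L.d (n + 1) n ≫ (ρ.a n).hom =
    ρ.p (n + 1) ≫ HomologicalComplex.homologyMap (R.ι n) 0 := by
  rw [ρ.comm, p, assoc]

lemma d_comp_p (n : ℕ) : ρ.L.d (n + 1) n ≫ ρ.p n = 0 := by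
  rw [p, ← assoc, d_comp_a, assoc, ← HomologicalComplex.homologyMap_comp, R.w,
    HomologicalComplex.homologyMap_zero, comp_zero]

/-- The differential factors through the epimorphism `ρ.p (n + 1)`, so exactness reduces to right
exactness of `H₀`. -/
lemma d_p_exact (n : ℕ) : (ShortComplex.mk _ _ (ρ.d_comp_p n)).Exact := by
  let φ : ShortComplex.mk _ _ (ρ.d_comp_p n) ⟶
      ShortComplex.mk _ _ (R.homologyMap_ι_π n) :=
    { τ₁ := ρ.p (n + 1)
      τ₂ := (ρ.a n).hom
      τ₃ := 𝟙 _
      comm₁₂ := (ρ.d_comp_a n).symm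
      comm₂₃ := (comp_id _).symm }
  have : Epi φ.τ₁ := inferInstanceAs (Epi (ρ.p (n + 1)))
  have : IsIso φ.τ₂ := inferInstanceAs (IsIso (ρ.a n).hom)
  have : Mono φ.τ₃ := inferInstanceAs (Mono (𝟙 _))
  exact (ShortComplex.exact_iff_of_epi_of_isIso_of_mono φ).2 (R.homology_zero_exact n)

/-- The identification of the opcycles. -/
def desc (n : ℕ) : ρ.L.opcycles n ⟶ (R.K n).homology 0 :=
  ρ.L.descOpcycles (ρ.p n) (n + 1) (by simp) (ρ.d_comp_p n)

lemma pOpcycles_desc (n : ℕ) : ρ.L.pOpcycles n ≫ ρ.desc n = ρ.p n := by simp [desc]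

instance (n : ℕ) : IsIso (ρ.desc n) := by
  have h := (ρ.d_p_exact n).gIsCokernel
  have h' := ρ.L.opcyclesIsCokernel (n + 1) n (by simp)
  have e : ρ.desc n = (h'.coconePointUniqueUpToIso h).hom := by
    rw [← cancel_epi (ρ.L.pOpcycles n), pOpcycles_desc]
    exact (h'.comp_coconePointUniqueUpToIso_hom h WalkingParallelPair.one).symm
  rw [e]
  infer_instance

/-- The homology of the complex, as a subobject of `H₀` of the syzygies. -/
def homologyIncl (n : ℕ) : ρ.L.homology n ⟶ (R.K n).homology 0 := ρ.L.homologyι n ≫ ρ.desc n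

instance (n : ℕ) : Mono (ρ.homologyIncl n) := mono_comp _ _

instance : IsIso (ρ.homologyIncl 0) :=
  have : IsIso (ρ.L.homologyι 0) := ChainComplex.isIso_homologyι₀ _
  inferInstanceAs (IsIso (_ ≫ _))

lemma desc_comp (n : ℕ) : ρ.desc (n + 1) ≫ HomologicalComplex.homologyMap (R.ι n) 0 =
    ρ.L.fromOpcycles (n + 1) n ≫ (ρ.a n).hom := by
  rw [← cancel_epi (ρ.L.pOpcycles (n + 1)), reassoc_of% pOpcycles_desc,
    HomologicalComplex.p_fromOpcycles_assoc, d_comp_a]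

lemma homologyIncl_comp (n : ℕ) :
    ρ.homologyIncl (n + 1) ≫ HomologicalComplex.homologyMap (R.ι n) 0 = 0 := by
  rw [homologyIncl, assoc, desc_comp, ← assoc, HomologicalComplex.homologyι_comp_fromOpcycles,
    zero_comp]

/-- Homology is the kernel of opcycles mapping to the previous term; the opcycles here are `H₀` of a
syzygy. -/
lemma homologyIncl_exact (n : ℕ) : (ShortComplex.mk _ _ (ρ.homologyIncl_comp n)).Exact := by
  have h := ShortComplex.exact_of_f_is_kernel
    (ShortComplex.mk _ _ (ρ.L.homologyι_comp_fromOpcycles (n + 1) n))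
    (ρ.L.homologyIsKernel (n + 1) n (by simp))
  refine ShortComplex.exact_of_iso ?_ h
  exact ShortComplex.isoMk (Iso.refl _) (asIso (ρ.desc (n + 1))) (ρ.a n)
    (by simp [homologyIncl]) (by simp [desc_comp])

/-- In degree `n + 1` both sides are kernels of `H₀(K (n + 1)) ⟶ H₀(E n)`. The compatibility with
the edge determines the isomorphism and later gives its naturality. -/
lemma exists_homologyIso (hR : R.IsAcyclic) (n : ℕ) :
    ∃ e : (R.K 0).homology n ≅ ρ.L.homology n, e.hom ≫ ρ.homologyIncl n = R.edge n := by
  match n with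
  | 0 => exact ⟨(asIso (ρ.homologyIncl 0)).symm, by simp [edge_zero]⟩
  | n + 1 =>
    have := hR.mono_edge (n + 1)
    have : Mono (ShortComplex.mk _ _ (R.edge_comp n)).f := hR.mono_edge (n + 1)
    have : Mono (ShortComplex.mk _ _ (ρ.homologyIncl_comp n)).f :=
      inferInstanceAs (Mono (ρ.homologyIncl (n + 1)))
    have h1 := (hR.edge_exact n).fIsKernel
    have h2 := (ρ.homologyIncl_exact n).fIsKernel
    exact ⟨h1.conePointUniqueUpToIso h2,
      h1.conePointUniqueUpToIso_hom_comp h2 WalkingParallelPair.zero⟩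

variable {R' : ExactTower C} (ρ' : R'.Realization)

lemma homologyIncl_naturality (f : Hom R R') (g : ρ.L ⟶ ρ'.L)
    (w : ∀ n, g.f n ≫ (ρ'.a n).hom = (ρ.a n).hom ≫ HomologicalComplex.homologyMap (f.e n) 0)
    (n : ℕ) : HomologicalComplex.homologyMap g n ≫ ρ'.homologyIncl n =
      ρ.homologyIncl n ≫ HomologicalComplex.homologyMap (f.k n) 0 := by
  rw [homologyIncl, homologyIncl, HomologicalComplex.homologyι_naturality_assoc, assoc]
  congr 1
  rw [← cancel_epi (ρ.L.pOpcycles n), HomologicalComplex.p_opcyclesMap_assoc, pOpcycles_desc,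
    reassoc_of% pOpcycles_desc, p, p, ← assoc, w, assoc, assoc,
    ← HomologicalComplex.homologyMap_comp,
    ← HomologicalComplex.homologyMap_comp, f.π_comm]

/-- A map of towers is a quasi-isomorphism on the resolved complexes if and only if it is one
after applying `H₀` to the terms. -/
lemma quasiIso_iff (hR : R.IsAcyclic) (hR' : R'.IsAcyclic) (f : Hom R R') (g : ρ.L ⟶ ρ'.L)
    (w : ∀ n, g.f n ≫ (ρ'.a n).hom = (ρ.a n).hom ≫ HomologicalComplex.homologyMap (f.e n) 0) :
    QuasiIso (f.k 0) ↔ QuasiIso g := by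
  rw [_root_.quasiIso_iff, _root_.quasiIso_iff]
  refine forall_congr' fun n => ?_
  rw [quasiIsoAt_iff_isIso_homologyMap, quasiIsoAt_iff_isIso_homologyMap]
  obtain ⟨e, he⟩ := ρ.exists_homologyIso hR n
  obtain ⟨e', he'⟩ := ρ'.exists_homologyIso hR' n
  have h : HomologicalComplex.homologyMap (f.k 0) n ≫ e'.hom =
      e.hom ≫ HomologicalComplex.homologyMap g n := by
    rw [← cancel_mono (ρ'.homologyIncl n), assoc, assoc, he', edge_naturality,
      homologyIncl_naturality ρ ρ' f g w, ← he, assoc]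
  exact (MorphismProperty.isomorphisms C).arrow_mk_iso_iff (Arrow.isoMk e e' h.symm)

end Realization

end ExactTower

end DimensionShifting

/-! ### Functoriality and exactness of the Bousfield-Kan complex. -/

section BkFunctor

/-- The inclusion of a summand in the simplicial replacement. -/
def ιRepl {A : Type u} [SmallCategory A] (X : AbPsh A) {n : SimplexCategoryᵒᵖ}
    (φ : ComposableArrows A n.unop.len) : X.obj (op φ.right) ⟶ (simplicialRepl X).obj n :=
  replι X φ

lemma simplicialRepl_hom_ext {A : Type u} [SmallCategory A] {X : AbPsh A} {n : SimplexCategoryᵒᵖ}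
    {M : AddCommGrpCat.{u}} {f g : (simplicialRepl X).obj n ⟶ M}
    (h : ∀ φ : ComposableArrows A n.unop.len, ιRepl X φ ≫ f = ιRepl X φ ≫ g) : f = g :=
  Sigma.hom_ext _ _ h

/-- The map on the terms of simplicial replacements induced by a morphism of presheaves. -/
def replMap {A : Type u} [SmallCategory A] {X Y : AbPsh A} (f : X ⟶ Y) (n : SimplexCategoryᵒᵖ) :
    (simplicialRepl X).obj n ⟶ (simplicialRepl Y).obj n :=
  Sigma.desc fun φ : ComposableArrows A n.unop.len => f.app (op φ.right) ≫ replι Y φ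

lemma ιRepl_replMap {A : Type u} [SmallCategory A] {X Y : AbPsh A} (f : X ⟶ Y)
    {n : SimplexCategoryᵒᵖ} (φ : ComposableArrows A n.unop.len) :
    ιRepl X φ ≫ replMap f n = f.app (op φ.right) ≫ ιRepl Y φ := Sigma.ι_desc _ _

lemma ιRepl_simplicialRepl_map {A : Type u} [SmallCategory A] (X : AbPsh A)
    {n m : SimplexCategoryᵒᵖ} (θ : n ⟶ m) (φ : ComposableArrows A n.unop.len) :
    ιRepl X φ ≫ (simplicialRepl X).map θ =
      X.map (pullRight θ.unop φ).op ≫ ιRepl X (pull θ.unop φ) := Sigma.ι_desc _ _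

/-- The simplicial replacement as a functor. -/
def simplicialReplFunctor (A : Type u) [SmallCategory A] :
    AbPsh A ⥤ SimplicialObject AddCommGrpCat.{u} where
  obj X := simplicialRepl X
  map {X Y} f :=
    { app n := replMap f n
      naturality n m θ := by
        apply simplicialRepl_hom_ext
        intro φ
        rw [reassoc_of% ιRepl_simplicialRepl_map, reassoc_of% ιRepl_replMap, ιRepl_replMap,
          ιRepl_simplicialRepl_map, f.naturality_assoc] }
  map_id X := by
    refine NatTrans.ext (funext fun n => ?_)
    apply simplicialRepl_hom_ext
    intro φ
    exact (ιRepl_replMap _ _).trans ((id_comp _).trans (comp_id _).symm)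
  map_comp {X Y Z} f g := by
    refine NatTrans.ext (funext fun n => ?_)
    apply simplicialRepl_hom_ext
    intro φ
    rw [NatTrans.comp_app, reassoc_of% ιRepl_replMap, ιRepl_replMap, ιRepl_replMap,
      NatTrans.comp_app,
      assoc]

/-- The Bousfield-Kan complex as a functor. -/
def bkFunctor (A : Type u) [SmallCategory A] : AbPsh A ⥤ ChainComplex AddCommGrpCat.{u} ℕ :=
  simplicialReplFunctor A ⋙ AlgebraicTopology.alternatingFaceMapComplex _

variable {A B : Type u} [SmallCategory A] [SmallCategory B]

/-- The inclusion of a summand in the Bousfield-Kan complex. -/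
def bkι (X : AbPsh A) {n : ℕ} (φ : ComposableArrows A n) :
    X.obj (op φ.right) ⟶ ((bkFunctor A).obj X).X n := replι X φ

lemma bk_hom_ext {X : AbPsh A} {n : ℕ} {M : AddCommGrpCat.{u}}
    {f g : ((bkFunctor A).obj X).X n ⟶ M}
    (h : ∀ φ : ComposableArrows A n, bkι X φ ≫ f = bkι X φ ≫ g) : f = g :=
  Sigma.hom_ext _ _ h

/-- Morphisms from the terms of the Bousfield-Kan complex. -/
def bkDesc {X : AbPsh A} {n : ℕ} {M : AddCommGrpCat.{u}}
    (f : ∀ φ : ComposableArrows A n, X.obj (op φ.right) ⟶ M) : ((bkFunctor A).obj X).X n ⟶ M :=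
  Sigma.desc f

lemma bkι_bkDesc {X : AbPsh A} {n : ℕ} {M : AddCommGrpCat.{u}}
    (f : ∀ φ : ComposableArrows A n, X.obj (op φ.right) ⟶ M) (φ : ComposableArrows A n) :
    bkι X φ ≫ bkDesc f = f φ := Sigma.ι_desc _ _

lemma bkι_map {X Y : AbPsh A} (f : X ⟶ Y) {n : ℕ} (φ : ComposableArrows A n) :
    bkι X φ ≫ ((bkFunctor A).map f).f n = f.app _ ≫ bkι Y φ :=
  ιRepl_replMap (n := op ⦋n⦌) f φ

lemma bkι_d (X : AbPsh A) {n : ℕ} (φ : ComposableArrows A (n + 1)) :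
    bkι X φ ≫ ((bkFunctor A).obj X).d (n + 1) n =
      ∑ i : Fin (n + 2), (-1 : ℤ) ^ (i : ℕ) •
        (X.map (pullRight (SimplexCategory.δ i) φ).op ≫
          bkι X (pull (SimplexCategory.δ i) φ : ComposableArrows A n)) := by
  refine (congrArg (bkι X φ ≫ ·) (AlgebraicTopology.AlternatingFaceMapComplex.obj_d_eq
    (simplicialRepl X) n)).trans ?_
  refine (Preadditive.comp_sum _ _ _).trans (Finset.sum_congr rfl fun i _ => ?_)
  refine (Preadditive.comp_zsmul _ _ _).trans (congrArg _ ?_)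
  exact Sigma.ι_desc _ _

/-- The target objects of the `n`-simplices of the nerve. -/
abbrev rightObj (A : Type u) [SmallCategory A] (n : ℕ) : Discrete (ComposableArrows A n) ⥤ Aᵒᵖ :=
  Discrete.functor fun φ => op φ.right

/-- The comparison of two descriptions of the terms of the Bousfield-Kan complex. -/
def bkXIso (X : AbPsh A) (n : ℕ) :
    ((bkFunctor A).obj X).X n ≅ colim.obj (rightObj A n ⋙ X) :=
  HasColimit.isoOfNatIso (Discrete.natIso fun _ => Iso.refl _)

lemma bkι_bkXIso (X : AbPsh A) {n : ℕ} (φ : ComposableArrows A n) :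
    bkι X φ ≫ (bkXIso X n).hom = colimit.ι (rightObj A n ⋙ X) ⟨φ⟩ :=
  (HasColimit.isoOfNatIso_ι_hom _ _).trans (id_comp _)

/-- The terms of the Bousfield-Kan complex are direct sums of evaluations. -/
def bkFunctorEval (A : Type u) [SmallCategory A] (n : ℕ) :
    bkFunctor A ⋙ HomologicalComplex.eval _ _ n ≅
      (Functor.whiskeringLeft _ _ AddCommGrpCat.{u}).obj (rightObj A n) ⋙ colim :=
  NatIso.ofComponents (fun X => bkXIso X n) (by
    intro X Y f
    apply bk_hom_ext
    intro φ
    refine ((reassoc_of% bkι_map f φ) _).trans ?_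
    rw [bkι_bkXIso]
    refine Eq.trans ?_ ((reassoc_of% bkι_bkXIso X φ) _).symm
    exact (ι_colimMap (Functor.whiskerLeft (rightObj A n) f) ⟨φ⟩).symm)

/-- Direct sums of abelian groups are exact, and evaluations of presheaves preserve all limits and
colimits; exactness of `bkFunctor` is then checked degree by degree. -/
instance (n : ℕ) : PreservesFiniteLimits (bkFunctor A ⋙ HomologicalComplex.eval _ _ n) :=
  preservesFiniteLimits_of_natIso (bkFunctorEval A n).symm

instance (J : Type u) (n : ℕ) :
    PreservesColimitsOfShape (Discrete J) (bkFunctor A ⋙ HomologicalComplex.eval _ _ n) :=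
  preservesColimitsOfShape_of_natIso (bkFunctorEval A n).symm

instance (n : ℕ) :
    PreservesFiniteColimits (bkFunctor A ⋙ HomologicalComplex.eval _ _ n) :=
  preservesFiniteColimits_of_natIso (bkFunctorEval A n).symm

instance (J : Type u) : PreservesColimitsOfShape (Discrete J) (bkFunctor A) :=
  HomologicalComplex.preservesColimitsOfShape_of_eval _ fun _ => inferInstance

instance : PreservesFiniteLimits (bkFunctor A) where
  preservesFiniteLimits _ _ _ := HomologicalComplex.preservesLimitsOfShape_of_eval _
    fun _ => PreservesFiniteLimits.preservesFiniteLimits _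

instance : PreservesFiniteColimits (bkFunctor A) where
  preservesFiniteColimits _ _ _ := HomologicalComplex.preservesColimitsOfShape_of_eval _
    fun _ => PreservesFiniteColimits.preservesFiniteColimits _

instance : (bkFunctor A).Additive where
  map_add {X Y f g} := by
    ext n : 1
    apply bk_hom_ext
    intro φ
    rw [HomologicalComplex.add_f_apply, Preadditive.comp_add, bkι_map, bkι_map, bkι_map,
      NatTrans.app_add, Preadditive.add_comp]

lemma bkι_lambdaPsh (F : A ⥤ B) (X : AbPsh B) {n : ℕ} (φ : ComposableArrows A n) :
    bkι ((restr F).obj X) φ ≫ HomologicalComplex.Hom.f (lambdaPsh F X) n =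
      bkι X ((F.mapComposableArrows n).obj φ) :=
  Sigma.ι_desc _ _

/-- The comparison of Bousfield-Kan complexes is natural. -/
@[simps]
def lambdaNat (F : A ⥤ B) : restr F ⋙ bkFunctor A ⟶ bkFunctor B where
  app X := lambdaPsh F X
  naturality X Y f := by
    ext n : 1
    apply bk_hom_ext
    intro φ
    refine ((reassoc_of% bkι_map _ φ) _).trans ?_
    refine (congrArg _ (bkι_lambdaPsh F Y φ)).trans ?_
    refine Eq.trans ?_ ((reassoc_of% bkι_lambdaPsh F X φ) _).symm
    exact (bkι_map _ _).symm

end BkFunctor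

/-! ### Degree-zero homology is the colimit. -/

section HomologyZero

variable {A B : Type u} [SmallCategory A] [SmallCategory B]

/-- The augmentation of the Bousfield-Kan complex. -/
def bkAug (X : AbPsh A) : ((bkFunctor A).obj X).X 0 ⟶ (colimA A).obj X :=
  bkDesc fun φ => colimit.ι X (op φ.right)

lemma bkι_bkAug (X : AbPsh A) (φ : ComposableArrows A 0) :
    bkι X φ ≫ bkAug X = colimit.ι X (op φ.right) := bkι_bkDesc _ _

lemma d_bkAug (X : AbPsh A) : ((bkFunctor A).obj X).d 1 0 ≫ bkAug X = 0 := by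
  apply bk_hom_ext
  intro φ
  rw [← assoc, bkι_d, Fin.sum_univ_two, Preadditive.add_comp, Preadditive.zsmul_comp,
    Preadditive.zsmul_comp, assoc, assoc, bkι_bkAug, bkι_bkAug]
  -- The two faces of an edge have the same image in the colimit and carry opposite signs.
  erw [colimit.w, colimit.w]
  simp

/-- The inclusion of the summand of a vertex. -/
def bkι₀ (X : AbPsh A) (a : Aᵒᵖ) : X.obj a ⟶ ((bkFunctor A).obj X).X 0 :=
  bkι X (ComposableArrows.mk₀ a.unop)

lemma bkι₀_bkAug (X : AbPsh A) (a : Aᵒᵖ) : bkι₀ X a ≫ bkAug X = colimit.ι X a := bkι_bkAug _ _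

lemma bkι_eq_bkι₀ (X : AbPsh A) (φ : ComposableArrows A 0) : bkι X φ = bkι₀ X (op φ.right) := by
  obtain ⟨a, rfl⟩ := ComposableArrows.mk₀_surjective φ
  rfl

/-- A face of an edge equals a vertex `mk₀ a` only propositionally; this carries the transport
between the two summands. -/
lemma map_bkι_eq_bkι₀ (X : AbPsh A) {φ : ComposableArrows A 0} {a b : A} (h : φ = .mk₀ a)
    (f : φ.right ⟶ b) (g : a ⟶ b) (w : f = eqToHom (by rw [h]; rfl) ≫ g) :
    X.map f.op ≫ bkι X φ = X.map g.op ≫ bkι₀ X (op a) := by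
  subst h
  obtain rfl : f = g := w.trans (id_comp g)
  rfl

lemma comp_eq_of_alternating_sum_comp_eq_zero {C : Type*} [Category* C] [Preadditive C]
    {P Q R : C} {x y : P ⟶ Q} {z : Q ⟶ R}
    (h : ((-1 : ℤ) ^ ((0 : Fin 2) : ℕ) • x + (-1 : ℤ) ^ ((1 : Fin 2) : ℕ) • y) ≫ z = 0) :
    y ≫ z = x ≫ z := by
  simp only [Fin.coe_ofNat_eq_mod, Nat.zero_mod, pow_zero, one_smul, Nat.mod_succ, pow_one,
    neg_smul, Preadditive.add_comp, Preadditive.neg_comp] at h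
  exact (eq_of_sub_eq_zero ((sub_eq_add_neg _ _).trans h)).symm

/-- The boundary of the summand of the edge `f` identifies an element over `a'` with its restriction
over `a`. This is the cocone condition needed to map the colimit to the opcycles. -/
lemma map_bkι₀_pOpcycles (X : AbPsh A) {a a' : A} (f : a ⟶ a') :
    X.map f.op ≫ bkι₀ X (op a) ≫ ((bkFunctor A).obj X).pOpcycles 0 =
      bkι₀ X (op a') ≫ ((bkFunctor A).obj X).pOpcycles 0 := by
  have h : bkι X (ComposableArrows.mk₁ f) ≫ ((bkFunctor A).obj X).d 1 0 ≫
      ((bkFunctor A).obj X).pOpcycles 0 = 0 := by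
    rw [HomologicalComplex.d_pOpcycles, comp_zero]
  rw [← assoc, bkι_d, Fin.sum_univ_two] at h
  have e0 := (map_bkι_eq_bkι₀ X (φ := pull (SimplexCategory.δ 0) (ComposableArrows.mk₁ f))
    (a := a') (ComposableArrows.ext₀ rfl) (pullRight (SimplexCategory.δ 0)
      (ComposableArrows.mk₁ f)) (𝟙 a') (((ComposableArrows.mk₁ f).map_id 1).trans
      (comp_id _).symm)).trans ((congrArg (· ≫ bkι₀ X (op a')) (X.map_id _)).trans (id_comp _))
  have e1 := map_bkι_eq_bkι₀ X (φ := pull (SimplexCategory.δ 1) (ComposableArrows.mk₁ f))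
    (a := a) (ComposableArrows.ext₀ rfl) (pullRight (SimplexCategory.δ 1)
      (ComposableArrows.mk₁ f)) f (id_comp _).symm
  rw [e0, e1] at h
  exact (assoc _ _ _).symm.trans (comp_eq_of_alternating_sum_comp_eq_zero h)

/-- The opcycles in degree `0` of the Bousfield-Kan complex form the colimit. -/
def bkOpcyclesIso (X : AbPsh A) : ((bkFunctor A).obj X).opcycles 0 ≅ (colimA A).obj X where
  hom := ((bkFunctor A).obj X).descOpcycles (bkAug X) 1 (by simp) (d_bkAug X)
  inv := colimit.desc X
    { pt := ((bkFunctor A).obj X).opcycles 0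
      ι :=
        { app a := bkι₀ X a ≫ ((bkFunctor A).obj X).pOpcycles 0
          naturality a a' f := (map_bkι₀_pOpcycles X f.unop).trans (comp_id _).symm } }
  hom_inv_id := by
    rw [← cancel_epi (((bkFunctor A).obj X).pOpcycles 0), HomologicalComplex.p_descOpcycles_assoc]
    apply bk_hom_ext
    intro φ
    rw [reassoc_of% bkι_bkAug, colimit.ι_desc, comp_id, bkι_eq_bkι₀]
  inv_hom_id := by
    apply colimit.hom_ext
    intro a
    rw [colimit.ι_desc_assoc, assoc, HomologicalComplex.p_descOpcycles]
    exact (bkι₀_bkAug X _).trans (comp_id _).symm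

lemma pOpcycles_bkOpcyclesIso_hom (X : AbPsh A) :
    ((bkFunctor A).obj X).pOpcycles 0 ≫ (bkOpcyclesIso X).hom = bkAug X := by
  simp [bkOpcyclesIso]

/-- `H₀` of the Bousfield-Kan complex is the colimit. -/
def bkHomologyZeroIso (X : AbPsh A) :
    ((bkFunctor A).obj X).homology 0 ≅ (colimA A).obj X :=
  ChainComplex.isoHomologyι₀ _ ≪≫ bkOpcyclesIso X

lemma bkHomologyZeroIso_hom (X : AbPsh A) : (bkHomologyZeroIso X).hom =
    ((bkFunctor A).obj X).homologyι 0 ≫ (bkOpcyclesIso X).hom := rfl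

lemma bkHomologyZeroIso_naturality {X Y : AbPsh A} (f : X ⟶ Y) :
    HomologicalComplex.homologyMap ((bkFunctor A).map f) 0 ≫ (bkHomologyZeroIso Y).hom =
      (bkHomologyZeroIso X).hom ≫ (colimA A).map f := by
  rw [bkHomologyZeroIso_hom, bkHomologyZeroIso_hom,
    HomologicalComplex.homologyι_naturality_assoc, assoc]
  congr 1
  rw [← cancel_epi (((bkFunctor A).obj X).pOpcycles 0), HomologicalComplex.p_opcyclesMap_assoc,
    pOpcycles_bkOpcyclesIso_hom, reassoc_of% pOpcycles_bkOpcyclesIso_hom]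
  apply bk_hom_ext
  intro φ
  rw [reassoc_of% bkι_map, bkι_bkAug, reassoc_of% bkι_bkAug]
  simp

/-- Both sides send the class of an element at a vertex `a` to its class at `F a`. -/
lemma bkHomologyZeroIso_lambdaNat (F : A ⥤ B) (X : AbPsh B) :
    HomologicalComplex.homologyMap ((lambdaNat F).app X) 0 ≫ (bkHomologyZeroIso X).hom =
      (bkHomologyZeroIso ((restr F).obj X)).hom ≫ (colimRestr F).app X := by
  rw [bkHomologyZeroIso_hom, bkHomologyZeroIso_hom,
    HomologicalComplex.homologyι_naturality_assoc, assoc]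
  congr 1
  rw [← cancel_epi (HomologicalComplex.pOpcycles _ 0), HomologicalComplex.p_opcyclesMap_assoc,
    pOpcycles_bkOpcyclesIso_hom]
  refine Eq.trans ?_ ((reassoc_of% pOpcycles_bkOpcyclesIso_hom ((restr F).obj X)) _).symm
  apply bk_hom_ext
  intro φ
  refine ((reassoc_of% bkι_lambdaPsh F X φ) _).trans ?_
  refine Eq.trans ?_ ((reassoc_of% bkι_bkAug _ φ) _).symm
  refine (bkι_bkAug X _).trans ?_
  exact (colimit.ι_pre X F.op (op φ.right)).symm

end HomologyZero

/-! ### Acyclicity of the nerve of a category with a terminal object. -/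

section NerveHomotopy

open MonoidalCategory CartesianMonoidalCategory

variable {C D : Type u} [SmallCategory C] [SmallCategory D]

/-- The simplex of `nerve D` given by a natural transformation `α`, a simplex of `nerve C` and
a simplex of `Δ[1]`. -/
def natTransSimplex {F G : C ⥤ D} (α : F ⟶ G) {n : ℕ} (φ : ComposableArrows C n)
    (θ : Fin (n + 1) →o Fin 2) : ComposableArrows D n :=
  θ.monotone.functor.prod' φ ⋙ Functor.uncurry.obj (ComposableArrows.mk₁ α)

/-- The homotopy between maps of nerves given by a natural transformation. -/
def nerveHomotopy {F G : C ⥤ D} (α : F ⟶ G) : SSet.Homotopy (nerveMap F) (nerveMap G) where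
  h :=
    { app n := ↾fun x => natTransSimplex α x.1 (SSet.stdSimplex.objEquiv x.2).toOrderHom
      naturality n m θ := rfl }
  h₀ := by
    refine NatTrans.ext (funext fun n => ConcreteCategory.hom_ext _ _ fun φ => ?_)
    refine CategoryTheory.Functor.ext (fun _ => rfl) fun i j f => ?_
    refine Eq.trans ?_ ((id_comp _).trans (comp_id _)).symm
    exact id_comp (F.map (CategoryTheory.Functor.map (show ComposableArrows C n.unop.len from φ) f))
  h₁ := by
    refine NatTrans.ext (funext fun n => ConcreteCategory.hom_ext _ _ fun φ => ?_)
    refine CategoryTheory.Functor.ext (fun _ => rfl) fun i j f => ?_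
    refine Eq.trans ?_ ((id_comp _).trans (comp_id _)).symm
    exact id_comp (G.map (CategoryTheory.Functor.map (show ComposableArrows C n.unop.len from φ) f))
  rel := by
    ext n ⟨x, y⟩
    exact x.2.elim

/-- The nerve of the punctual category is constant. -/
def nervePUnitIso : nerve (Discrete PUnit.{u + 1}) ≅
    (Functor.const _).obj (PUnit.{u + 1} : Type u) :=
  NatIso.ofComponents fun n =>
    { hom := ↾fun _ => PUnit.unit
      inv := ↾fun _ => (Functor.const _).obj ⟨PUnit.unit⟩
      hom_inv_id := ConcreteCategory.hom_ext _ _ fun φ => Functor.punit_ext' _ _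
      inv_hom_id := rfl }

lemma exactAt_nerve_punit (R : AddCommGrpCat.{u}) (n : ℕ) :
    ((nerve (Discrete PUnit.{u + 1})).chainComplex R).ExactAt (n + 1) :=
  .of_iso (ChainComplex.alternatingConst_exactAt _ _ (Nat.succ_ne_zero n))
    ((AlgebraicTopology.alternatingFaceMapComplex _).mapIso
      (((SimplicialObject.whiskering _ _).obj (sigmaConst.obj R)).mapIso nervePUnitIso ≪≫
        Functor.constComp _ _ _) ≪≫ AlgebraicTopology.alternatingFaceMapComplexConst.app _).symm

/-- The maps to `t` form a natural transformation from the identity to a functor factoring through a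
point, so the identity on homology factors through the homology of a point. -/
lemma isZero_homology_nerve_of_isTerminal {t : C} (ht : IsTerminal t) (R : AddCommGrpCat.{u})
    (n : ℕ) : IsZero ((nerve C).homology R (n + 1)) := by
  let α : 𝟭 C ⟶ Functor.star.{u} C ⋙ Functor.fromPUnit.{u} t :=
    { app c := ht.from c
      naturality _ _ _ := ht.hom_ext _ _ }
  have h := (nerveHomotopy α).congr_homologyMap R (n + 1)
  have h1 : nerveMap (𝟭 C) = 𝟙 _ := rfl
  have h2 : nerveMap (Functor.star.{u} C ⋙ Functor.fromPUnit.{u} t) =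
    nerveMap (Functor.star.{u} C) ≫ nerveMap (Functor.fromPUnit.{u} t) := rfl
  rw [h1, h2, SSet.homologyMap_id, SSet.homologyMap_comp] at h
  rw [IsZero.iff_id_eq_zero, h, (exactAt_nerve_punit R n).isZero_homology.eq_of_tgt
    (SSet.homologyMap (nerveMap (Functor.star.{u} C)) R (n + 1)) 0, zero_comp]

end NerveHomotopy

/-! ### Integral chains of nerves as Bousfield-Kan complexes. -/

section NerveChains

variable {A B : Type u} [SmallCategory A] [SmallCategory B]

/-- The coefficients. -/
abbrev coeffZ : AddCommGrpCat.{u} := AddCommGrpCat.of (ULift.{u} ℤ)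

/-- The morphism from `ℤ` determined by an element. -/
def elemHom {M : AddCommGrpCat.{u}} (x : M) : coeffZ.{u} ⟶ M :=
  AddCommGrpCat.ofHom ((zmultiplesHom M x).comp AddEquiv.ulift.toAddMonoidHom)

@[simp]
lemma elemHom_one {M : AddCommGrpCat.{u}} (x : M) : elemHom x (ULift.up 1) = x :=
  one_zsmul x

lemma coeffZ_hom_ext {M : AddCommGrpCat.{u}} {f g : coeffZ.{u} ⟶ M}
    (h : f (ULift.up 1) = g (ULift.up 1)) : f = g := by
  ext x
  obtain ⟨n⟩ := x
  have hn : (ULift.up n : ULift.{u} ℤ) = n • ULift.up 1 := by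
    ext
    simp
  rw [hn]
  exact (map_zsmul f.hom n _).trans ((congrArg (n • ·) h).trans (map_zsmul g.hom n _).symm)

lemma elemHom_comp {M N : AddCommGrpCat.{u}} (x : M) (f : M ⟶ N) :
    elemHom x ≫ f = elemHom (f x) :=
  coeffZ_hom_ext (by
    rw [ConcreteCategory.comp_apply, elemHom_one, elemHom_one])

/-! ### Constant coefficients -/

/-- The Bousfield-Kan complex of the constant presheaf computes integral chains of the nerve. -/
def bkConstZIso (A : Type u) [SmallCategory A] :
    (bkFunctor A).obj (constZ A) ≅ (nerve A).chainComplex coeffZ.{u} :=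
  HomologicalComplex.Hom.isoOfComponents (fun _ => Iso.refl _) (by
    rintro _ n rfl
    apply bk_hom_ext
    intro φ
    refine (congrArg _ (id_comp _)).trans ?_
    refine ((SSet.ιChainComplex_d (X := nerve A) (R := coeffZ.{u}) φ).trans ?_).trans
      (congrArg _ (comp_id _)).symm
    refine Eq.trans ?_ (bkι_d (constZ A) φ).symm
    exact Finset.sum_congr rfl fun i _ => congrArg _ (id_comp _).symm)

lemma quasiIso_lambdaPsh_constZ_iff (G : A ⥤ B) :
    QuasiIso (lambdaPsh G (constZ B)) ↔
      QuasiIso (SSet.chainComplexMap (nerveMap G) coeffZ.{u}) :=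
  (HomologicalComplex.quasiIso _ _).arrow_mk_iso_iff (Arrow.isoMk (bkConstZIso A)
    (bkConstZIso B) (by
      ext n : 1
      apply bk_hom_ext
      intro φ
      refine (congrArg (bkι (constZ A) φ ≫ ·) (id_comp _)).trans ?_
      refine (SSet.ι_chainComplexMap_f _ _ (nerveMap G) coeffZ.{u} φ).trans ?_
      refine Eq.trans ?_ (congrArg (bkι (constZ A) φ ≫ ·) (comp_id _)).symm
      exact (bkι_lambdaPsh G (constZ B) φ).symm))

/-! ### Representable coefficients -/

variable (F : A ⥤ B) (b : B)

/-- The simplex of the nerve underlying a simplex of the nerve of a comma category. -/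
def projSimplex {n : ℕ} (ψ : ComposableArrows (CostructuredArrow F b) n) : ComposableArrows A n :=
  ψ ⋙ CostructuredArrow.proj F b

/-- The augmentation of a simplex of the nerve of a comma category. -/
def augHom {n : ℕ} (ψ : ComposableArrows (CostructuredArrow F b) n) :
    F.obj (projSimplex F b ψ).right ⟶ b :=
  ψ.right.hom

/-- The element of a free presheaf given by a morphism. -/
def freeElem {a : A} (f : F.obj a ⟶ b) : ((restr F).obj (freeRep B b)).obj (op a) :=
  FreeAbelianGroup.of f

lemma map_freeElem {a a' : A} (g : a ⟶ a') (f : F.obj a' ⟶ b) :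
    ((restr F).obj (freeRep B b)).map g.op (freeElem F b f) = freeElem F b (F.map g ≫ f) :=
  FreeAbelianGroup.map_of_apply _

lemma freeElem_hom_ext {a : A} {M : AddCommGrpCat.{u}}
    {f g : ((restr F).obj (freeRep B b)).obj (op a) ⟶ M}
    (h : ∀ x : F.obj a ⟶ b, f (freeElem F b x) = g (freeElem F b x)) : f = g :=
  AddCommGrpCat.hom_ext (FreeAbelianGroup.lift_ext f.hom g.hom h)

/-- The map from a summand of the chains of the nerve of a comma category. -/
def freeRepι {n : ℕ} (ψ : ComposableArrows (CostructuredArrow F b) n) :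
    coeffZ.{u} ⟶ ((bkFunctor A).obj ((restr F).obj (freeRep B b))).X n :=
  elemHom (freeElem F b (augHom F b ψ)) ≫ bkι ((restr F).obj (freeRep B b)) (projSimplex F b ψ)

/-- The comparison between the chains of the nerve of a comma category and a Bousfield-Kan
complex, in degree `n`. -/
def freeRepMapX (n : ℕ) : ((nerve (CostructuredArrow F b)).chainComplex coeffZ.{u}).X n ⟶
    ((bkFunctor A).obj ((restr F).obj (freeRep B b))).X n :=
  Sigma.desc (freeRepι F b)

/-- The summands of the chains of the nerve. -/
abbrev nerveι {n : ℕ} (ψ : ComposableArrows (CostructuredArrow F b) n) :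
    coeffZ.{u} ⟶ ((nerve (CostructuredArrow F b)).chainComplex coeffZ.{u}).X n :=
  SSet.ιChainComplex (X := nerve (CostructuredArrow F b)) (n := n) ψ

lemma ι_freeRepMapX {n : ℕ} (ψ : ComposableArrows (CostructuredArrow F b) n) :
    nerveι F b ψ ≫ freeRepMapX F b n = freeRepι F b ψ :=
  Sigma.ι_desc _ _

lemma freeRepι_d {n : ℕ} (ψ : ComposableArrows (CostructuredArrow F b) (n + 1)) :
    freeRepι F b ψ ≫ ((bkFunctor A).obj ((restr F).obj (freeRep B b))).d (n + 1) n =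
      ∑ i : Fin (n + 2), (-1 : ℤ) ^ (i : ℕ) •
        freeRepι F b (n := n) (pull (SimplexCategory.δ i) ψ) := by
  rw [freeRepι, assoc, bkι_d, Preadditive.comp_sum]
  refine Finset.sum_congr rfl fun i _ => ?_
  rw [Preadditive.comp_zsmul, reassoc_of% elemHom_comp]
  refine congrArg (_ • ·) (congrArg (· ≫ bkι ((restr F).obj (freeRep B b))
    (pull (SimplexCategory.δ i) (projSimplex F b ψ))) (congrArg elemHom ?_))
  refine (map_freeElem F b _ _).trans (congrArg (freeElem F b) ?_)
  -- When a face drops the last vertex, restricting the augmentation gives the structure arrow of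
  -- the new last vertex: this is commutativity of the triangle in the comma category.
  exact CostructuredArrow.w (pullRight (SimplexCategory.δ i) ψ)

/-- The chains of the nerve of a comma category, as a Bousfield-Kan complex. -/
def freeRepMap : (nerve (CostructuredArrow F b)).chainComplex coeffZ.{u} ⟶
    (bkFunctor A).obj ((restr F).obj (freeRep B b)) where
  f n := freeRepMapX F b n
  comm' := by
    rintro _ n rfl
    apply SSet.chainComplex_hom_ext
    intro ψ
    rw [SSet.ιChainComplex_d_assoc, Preadditive.sum_comp]
    refine ((reassoc_of% ι_freeRepMapX F b ψ) _).trans ((freeRepι_d F b ψ).trans ?_)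
    refine Finset.sum_congr rfl fun i _ => ?_
    rw [Preadditive.zsmul_comp]
    exact congrArg (_ • ·) (ι_freeRepMapX F b _).symm

/-- The simplex of the nerve of a comma category determined by a simplex of the nerve and an
augmentation. -/
@[simps]
def commaSimplex {n : ℕ} (φ : ComposableArrows A n) (f : F.obj φ.right ⟶ b) :
    ComposableArrows (CostructuredArrow F b) n where
  obj i := CostructuredArrow.mk (F.map (φ.map (homOfLE (Fin.le_last i))) ≫ f)
  map {i j} g := CostructuredArrow.homMk (φ.map g) (by
    dsimp
    rw [← assoc, ← F.map_comp, ← φ.map_comp]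
    rfl)

/-- The last structure arrow determines the earlier ones by composition, so a chain in the comma
category carries no other data beyond the underlying chain. -/
lemma commaSimplex_eq {n : ℕ} (ψ : ComposableArrows (CostructuredArrow F b) n) :
    commaSimplex F b (projSimplex F b ψ) (augHom F b ψ) = ψ := by
  refine CategoryTheory.Functor.ext (fun i => ?_) ?_
  · have h := CostructuredArrow.w (ψ.map (homOfLE (Fin.le_last i)))
    exact (congrArg CostructuredArrow.mk h).trans (CostructuredArrow.eq_mk _).symm
  · intro i j g
    apply CostructuredArrow.hom_ext
    refine Eq.symm ((Comma.comp_left).trans ?_)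
    refine (congrArg₂ (· ≫ ·) (CostructuredArrow.eqToHom_left _) ((Comma.comp_left).trans
      (congrArg _ (CostructuredArrow.eqToHom_left _)))).trans ?_
    exact (id_comp _).trans (comp_id _)

lemma augHom_commaSimplex {n : ℕ} (φ : ComposableArrows A n) (f : F.obj φ.right ⟶ b) :
    augHom F b (commaSimplex F b φ f) = f :=
  (congrArg (F.map · ≫ f) (φ.map_id _)).trans ((congrArg (· ≫ f) (F.map_id _)).trans (id_comp f))

/-- The inverse of `freeRepMap` on a summand. -/
def freeRepInvι {n : ℕ} (φ : ComposableArrows A n) :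
    ((restr F).obj (freeRep B b)).obj (op φ.right) ⟶
      ((nerve (CostructuredArrow F b)).chainComplex coeffZ.{u}).X n :=
  AddCommGrpCat.ofHom (FreeAbelianGroup.lift fun f : F.obj φ.right ⟶ b =>
    nerveι F b (commaSimplex F b φ f) (ULift.up 1))

lemma freeRepInvι_freeElem {n : ℕ} (φ : ComposableArrows A n) (f : F.obj φ.right ⟶ b) :
    freeRepInvι F b φ (freeElem F b f) = nerveι F b (commaSimplex F b φ f) (ULift.up 1) :=
  FreeAbelianGroup.lift_apply_of _ _

lemma freeRepMapX_bkDesc (n : ℕ) :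
    freeRepMapX F b n ≫ bkDesc (fun φ => freeRepInvι F b φ) = 𝟙 _ := by
  apply SSet.chainComplex_hom_ext
  intro ψ
  refine ((reassoc_of% ι_freeRepMapX F b ψ) _).trans ?_
  refine (assoc _ _ _).trans ?_
  rw [bkι_bkDesc, elemHom_comp, freeRepInvι_freeElem, comp_id]
  apply coeffZ_hom_ext
  rw [elemHom_one]
  exact congrArg (fun t => nerveι F b t (ULift.up 1)) (commaSimplex_eq F b ψ)

lemma bkDesc_freeRepMapX (n : ℕ) :
    bkDesc (fun φ => freeRepInvι F b φ) ≫ freeRepMapX F b n = 𝟙 _ := by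
  apply bk_hom_ext
  intro φ
  rw [reassoc_of% bkι_bkDesc, comp_id]
  apply freeElem_hom_ext
  intro f
  refine (ConcreteCategory.comp_apply _ _ _).trans ?_
  rw [freeRepInvι_freeElem]
  refine (ConcreteCategory.comp_apply _ _ _).symm.trans ?_
  refine (ConcreteCategory.congr_hom (ι_freeRepMapX F b (commaSimplex F b φ f)) _).trans ?_
  refine (ConcreteCategory.comp_apply _ _ _).trans ?_
  rw [elemHom_one, augHom_commaSimplex]
  rfl

instance (n : ℕ) : IsIso ((freeRepMap F b).f n) :=
  ⟨_, freeRepMapX_bkDesc F b n, bkDesc_freeRepMapX F b n⟩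

instance : IsIso (freeRepMap F b) := HomologicalComplex.Hom.isIso_of_components _

/-- The chains of the nerve of a comma category are a Bousfield-Kan complex. -/
def freeRepIso : (nerve (CostructuredArrow F b)).chainComplex coeffZ.{u} ≅
    (bkFunctor A).obj ((restr F).obj (freeRep B b)) := asIso (freeRepMap F b)

/-- `Over b` is the comma category of `𝟭 B` over `b`, so the same construction serves the target. -/
lemma freeRepMap_naturality :
    freeRepMap F b ≫ lambdaPsh F (freeRep B b) = lambdaObj F b ≫ freeRepMap (𝟭 B) b := by
  ext n : 1
  apply SSet.chainComplex_hom_ext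
  intro ψ
  refine ((reassoc_of% ι_freeRepMapX F b ψ) _).trans ?_
  refine Eq.trans ?_ (SSet.ι_chainComplexMap_f_assoc _ _
    (nerveMap (CostructuredArrow.toOver F b)) coeffZ.{u} ψ _).symm
  refine Eq.trans ?_ (ι_freeRepMapX (𝟭 B) b
    (((CostructuredArrow.toOver F b).mapComposableArrows n).obj ψ)).symm
  refine (assoc _ _ _).trans ?_
  exact congrArg (elemHom (freeElem F b (augHom F b ψ)) ≫ ·) (bkι_lambdaPsh F (freeRep B b) _)

lemma quasiIso_lambdaPsh_freeRep_iff :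
    QuasiIso (lambdaPsh F (freeRep B b)) ↔ QuasiIso (lambdaObj F b) :=
  ((HomologicalComplex.quasiIso _ _).arrow_mk_iso_iff
    (Arrow.isoMk (f := Arrow.mk (lambdaObj F b)) (g := Arrow.mk (lambdaPsh F (freeRep B b)))
      (freeRepIso F b) (freeRepIso (𝟭 B) b) (freeRepMap_naturality F b))).symm

end NerveChains

/-! ### Projective presheaves -/

section ExactCoproducts

/-- A coproduct of complexes which are exact in a certain degree is exact in this degree. -/
lemma exactAt_of_isColimit {J : Type u} {K : Discrete J ⥤ ChainComplex AddCommGrpCat.{u} ℕ}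
    {c : Cocone K} (hc : IsColimit c) (n : ℕ) (h : ∀ j, (K.obj j).ExactAt n) :
    c.pt.ExactAt n := by
  let S : ShortComplex (Discrete J ⥤ AddCommGrpCat.{u}) :=
    (ShortComplex.FunctorEquivalence.inverse _ _).obj
      (K ⋙ HomologicalComplex.shortComplexFunctor _ _ n)
  have hS : S.Exact := by
    rw [ShortComplex.exact_iff_isZero_homology, Functor.isZero_iff]
    intro j
    exact ((ShortComplex.exact_iff_isZero_homology _).1 (h j)).of_iso
      (S.mapHomologyIso ((evaluation _ _).obj j)).symm
  -- Exactness was checked pointwise in the functor category; coproducts of abelian groups preserve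
  -- it.
  exact colim.exact_mapShortComplex hS
    (isColimitOfPreserves (HomologicalComplex.eval _ _ _) hc)
    (isColimitOfPreserves (HomologicalComplex.eval _ _ _) hc)
    (isColimitOfPreserves (HomologicalComplex.eval _ _ _) hc)
    (c.pt.d _ _) (c.pt.d _ _) (fun j => (c.ι.app j).comm _ _) (fun j => (c.ι.app j).comm _ _)

end ExactCoproducts

section Projective

variable {A B : Type u} [SmallCategory A] [SmallCategory B]

/-- A projective presheaf is a direct factor of a coproduct of free presheaves on representable
presheaves. -/
lemma exists_retract_coproduct (P : AbPsh A) [Projective P] :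
    ∃ (J : Type u) (s : J → A), Nonempty (Retract P (∐ fun j => freeRep A (s j))) := by
  let f : (∐ fun s : (Σ a : A, P.obj (op a)) => freeRep A s.1) ⟶ P :=
    Sigma.desc fun s => freeRepHom A s.2
  have (c : Aᵒᵖ) : Epi (f.app c) := by
    rw [AddCommGrpCat.epi_iff_surjective]
    intro x
    obtain ⟨y, hy⟩ := exists_freeRepHom A (a := c.unop) (X := P) x
    refine ⟨(Sigma.ι (fun s : (Σ a : A, P.obj (op a)) => freeRep A s.1) ⟨c.unop, x⟩).app c y, ?_⟩
    have hc := congrArg (fun t => t.app c) (Sigma.ι_desc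
      (fun s : (Σ a : A, P.obj (op a)) => freeRepHom A s.2) ⟨c.unop, x⟩)
    exact (ConcreteCategory.congr_hom hc y).trans hy
  have : Epi f := NatTrans.epi_of_epi_app f
  exact ⟨_, _, ⟨{ i := Projective.factorThru (𝟙 P) f, r := f }⟩⟩

lemma projective_induction (W : AbPsh A → Prop)
    (hr : ∀ ⦃X Y : AbPsh A⦄, Retract X Y → W Y → W X)
    (hc : ∀ ⦃J : Type u⦄ (X : J → AbPsh A), (∀ j, W (X j)) → W (∐ X))
    (hf : ∀ a, W (freeRep A a)) (P : AbPsh A) [Projective P] : W P := by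
  obtain ⟨J, s, ⟨r⟩⟩ := exists_retract_coproduct P
  exact hr r (hc _ fun j => hf (s j))

variable (F : A ⥤ B)

/-- Restriction and the Bousfield-Kan functor preserve coproducts, and vanishing of a functor's
values passes to retracts. -/
lemma exactAt_bk_restr_of_projective (n : ℕ)
    (h : ∀ b, ((bkFunctor A).obj ((restr F).obj (freeRep B b))).ExactAt n) (P : AbPsh B)
    [Projective P] : ((bkFunctor A).obj ((restr F).obj P)).ExactAt n := by
  refine projective_induction
    (fun P => ((bkFunctor A).obj ((restr F).obj P)).ExactAt n) ?_ ?_ h P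
  · intro X Y r hY
    rw [HomologicalComplex.exactAt_iff_isZero_homology] at hY ⊢
    let G := restr F ⋙ bkFunctor A ⋙ HomologicalComplex.homologyFunctor _ _ n
    let r' := r.map G
    have : Mono r'.i := ⟨fun a b h => by
      have h' := congrArg (· ≫ r'.r) h
      simpa only [assoc, r'.retract, comp_id] using h'⟩
    have hX : IsZero (G.obj X) := IsZero.of_mono r'.i hY
    exact hX
  · intro J X hX
    exact exactAt_of_isColimit (isColimitOfPreserves (bkFunctor A)
      (isColimitOfPreserves (restr F) (coproductIsCoproduct X))) n fun j => hX j.as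

/-- Both functors compared by `colimRestr` preserve coproducts, and isomorphisms are stable under
retracts of arrows. -/
lemma isIso_colimRestr_of_projective (h : ∀ b, IsIso ((colimRestr F).app (freeRep B b)))
    (P : AbPsh B) [Projective P] : IsIso ((colimRestr F).app P) := by
  refine projective_induction (fun P => IsIso ((colimRestr F).app P)) ?_ ?_ h P
  · intro X Y r hY
    exact (MorphismProperty.isomorphisms _).of_retract
      { i := Arrow.homMk ((restr F ⋙ colimA A).map r.i) ((colimA B).map r.i)
          ((colimRestr F).naturality _)
        r := Arrow.homMk ((restr F ⋙ colimA A).map r.r) ((colimA B).map r.r)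
          ((colimRestr F).naturality _)
        retract := by
          apply Arrow.hom_ext
          · exact (r.map (restr F ⋙ colimA A)).retract
          · exact (r.map (colimA B)).retract } hY
  · intro J X hX
    have : IsIso (Functor.whiskerLeft (Discrete.functor X) (colimRestr F)) := by
      have (j : Discrete J) :
          IsIso ((Functor.whiskerLeft (Discrete.functor X) (colimRestr F)).app j) := hX j.as
      exact NatIso.isIso_of_isIso_app _
    exact isIso_app_coconePt_of_preservesColimit (Discrete.functor X) (colimRestr F) _
      (coproductIsCoproduct X)

/-- The complex is the chain complex of the nerve of `B/b`, whose terminal object is the identity of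
`b`. -/
lemma exactAt_bk_freeRep (b : B) (n : ℕ) :
    ((bkFunctor B).obj (freeRep B b)).ExactAt (n + 1) := by
  have h := isZero_homology_nerve_of_isTerminal
    (CostructuredArrow.mkIdTerminal (S := 𝟭 B) (Y := b)) coeffZ.{u} n
  exact ((HomologicalComplex.exactAt_iff_isZero_homology _ _).2 h).of_iso (freeRepIso (𝟭 B) b)

/-- Projective presheaves have no higher homology. -/
lemma exactAt_bk_of_projective (P : AbPsh A) [Projective P] (n : ℕ) :
    ((bkFunctor A).obj P).ExactAt (n + 1) :=
  exactAt_bk_restr_of_projective (𝟭 A) (n + 1) (fun a => exactAt_bk_freeRep a n) P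

lemma exactAt_bk_restr_freeRep (b : B) (h : QuasiIso (lambdaPsh F (freeRep B b))) (n : ℕ) :
    ((bkFunctor A).obj ((restr F).obj (freeRep B b))).ExactAt (n + 1) := by
  have h' : QuasiIsoAt (lambdaPsh F (freeRep B b)) (n + 1) := h.quasiIsoAt _
  exact (quasiIsoAt_iff_exactAt' _ _ (exactAt_bk_freeRep b n)).1 h'

lemma isIso_colimRestr_of_quasiIso (X : AbPsh B) (h : QuasiIso (lambdaPsh F X)) :
    IsIso ((colimRestr F).app X) := by
  have h' : QuasiIsoAt (lambdaPsh F X) 0 := h.quasiIsoAt _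
  rw [quasiIsoAt_iff_isIso_homologyMap] at h'
  have h2 : IsIso (HomologicalComplex.homologyMap ((lambdaNat F).app X) 0) := h'
  have h3 := bkHomologyZeroIso_lambdaNat F X
  exact IsIso.of_isIso_fac_left h3.symm

end Projective

/-! ### Resolutions and the Bousfield-Kan complex -/

section ResolutionTower

variable {D D' C : Type*} [Category* D] [Abelian D] [Category* D'] [Abelian D']
  [Category* C] [Abelian C]

lemma fromOpcycles_pOpcycles (L : ChainComplex D ℕ) (n : ℕ) :
    L.fromOpcycles (n + 1) n ≫ L.pOpcycles n = 0 := by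
  rw [← cancel_epi (L.pOpcycles (n + 1)), HomologicalComplex.p_fromOpcycles_assoc,
    HomologicalComplex.d_pOpcycles, comp_zero]

/-- The opcycles play the role of syzygies. The kernel of `L.fromOpcycles (n + 1) n` is the homology
in degree `n + 1`, so exactness there gives injectivity. -/
lemma opcycles_shortExact (L : ChainComplex D ℕ) (n : ℕ) (h : L.ExactAt (n + 1)) :
    (ShortComplex.mk _ _ (fromOpcycles_pOpcycles L n)).ShortExact where
  exact := by
    let φ : ShortComplex.mk _ _ (L.d_pOpcycles (n + 1) n) ⟶
        ShortComplex.mk _ _ (fromOpcycles_pOpcycles L n) :=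
      { τ₁ := L.pOpcycles (n + 1)
        τ₂ := 𝟙 _
        τ₃ := 𝟙 _ }
    have : Epi φ.τ₁ := inferInstanceAs (Epi (L.pOpcycles (n + 1)))
    have : IsIso φ.τ₂ := inferInstanceAs (IsIso (𝟙 _))
    have : Mono φ.τ₃ := inferInstanceAs (Mono (𝟙 _))
    exact (ShortComplex.exact_iff_of_epi_of_isIso_of_mono φ).1
      (ShortComplex.exact_of_g_is_cokernel _ (L.opcyclesIsCokernel (n + 1) n (by simp)))
  mono_f := Preadditive.mono_of_isZero_kernel' _ (L.homologyIsKernel (n + 1) n (by simp))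
    h.isZero_homology
  epi_g := inferInstanceAs (Epi (L.pOpcycles n))

variable (G : D ⥤ ChainComplex C ℕ) [G.PreservesZeroMorphisms] [PreservesFiniteLimits G]
  [PreservesFiniteColimits G]

/-- The tower obtained by applying an exact functor to a complex which is exact in positive
degrees. -/
@[simps]
def resolutionTower (L : ChainComplex D ℕ) (hL : ∀ n, L.ExactAt (n + 1)) : ExactTower C where
  K n := G.obj (L.opcycles n)
  E n := G.obj (L.X n)
  ι n := G.map (L.fromOpcycles (n + 1) n)
  π n := G.map (L.pOpcycles n)
  w n := by rw [← G.map_comp, fromOpcycles_pOpcycles, G.map_zero]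
  shortExact n := (opcycles_shortExact L n (hL n)).map_of_exact G

variable {G} in
/-- The complex obtained by applying `H₀ G` to a complex which is exact in positive degrees. -/
def resolutionRealization {T : D ⥤ C} [T.PreservesZeroMorphisms]
    (α : T ≅ G ⋙ HomologicalComplex.homologyFunctor _ _ 0)
    (L : ChainComplex D ℕ) (hL : ∀ n, L.ExactAt (n + 1)) :
    (resolutionTower G L hL).Realization where
  L := (T.mapHomologicalComplex _).obj L
  a n := α.app (L.X n)
  comm n := by
    refine (α.hom.naturality (L.d (n + 1) n)).trans ?_
    refine congrArg (α.hom.app (L.X (n + 1)) ≫ ·) ?_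
    refine Eq.trans ?_ (HomologicalComplex.homologyMap_comp _ _ _)
    refine congrArg (HomologicalComplex.homologyMap · 0) ?_
    exact (congrArg G.map (L.p_fromOpcycles (n + 1) n)).symm.trans (G.map_comp _ _)

variable {F : D' ⥤ D} [F.PreservesZeroMorphisms]

/-- The components of a morphism to the image of a complex by a functor. -/
def liftf {L : ChainComplex D ℕ} {M : ChainComplex D' ℕ}
    (φ : L ⟶ (F.mapHomologicalComplex _).obj M) (n : ℕ) : L.X n ⟶ F.obj (M.X n) := φ.f n

lemma liftf_d {L : ChainComplex D ℕ} {M : ChainComplex D' ℕ}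
    (φ : L ⟶ (F.mapHomologicalComplex _).obj M) (n : ℕ) :
    liftf φ (n + 1) ≫ F.map (M.d (n + 1) n) = L.d (n + 1) n ≫ liftf φ n :=
  φ.comm (n + 1) n

/-- The map on opcycles induced by a morphism of complexes. -/
def opcyclesTo {L : ChainComplex D ℕ} {M : ChainComplex D' ℕ}
    (φ : L ⟶ (F.mapHomologicalComplex _).obj M) (n : ℕ) :
    L.opcycles n ⟶ F.obj (M.opcycles n) :=
  L.descOpcycles (liftf φ n ≫ F.map (M.pOpcycles n)) (n + 1) (by simp) (by
    rw [← reassoc_of% liftf_d φ, ← F.map_comp, M.d_pOpcycles, F.map_zero, comp_zero])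

lemma pOpcycles_opcyclesTo {L : ChainComplex D ℕ} {M : ChainComplex D' ℕ}
    (φ : L ⟶ (F.mapHomologicalComplex _).obj M) (n : ℕ) :
    L.pOpcycles n ≫ opcyclesTo φ n = liftf φ n ≫ F.map (M.pOpcycles n) :=
  L.p_descOpcycles _ _ _ _

lemma opcyclesTo_fromOpcycles {L : ChainComplex D ℕ} {M : ChainComplex D' ℕ}
    (φ : L ⟶ (F.mapHomologicalComplex _).obj M) (n : ℕ) :
    opcyclesTo φ (n + 1) ≫ F.map (M.fromOpcycles (n + 1) n) =
      L.fromOpcycles (n + 1) n ≫ liftf φ n := by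
  rw [← cancel_epi (L.pOpcycles (n + 1)), reassoc_of% pOpcycles_opcyclesTo,
    HomologicalComplex.p_fromOpcycles_assoc, ← F.map_comp, HomologicalComplex.p_fromOpcycles,
    liftf_d]

/-- Opcycles are a cokernel, which a right exact functor preserves. -/
instance isIso_opcyclesTo_id [PreservesFiniteColimits F] (M : ChainComplex D' ℕ) (n : ℕ) :
    IsIso (opcyclesTo (𝟙 ((F.mapHomologicalComplex _).obj M)) n) := by
  let L := (F.mapHomologicalComplex (ComplexShape.down ℕ)).obj M
  have h := CokernelCofork.mapIsColimit _ (M.opcyclesIsCokernel (n + 1) n (by simp)) F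
  have h' := L.opcyclesIsCokernel (n + 1) n (by simp)
  let e : L.opcycles n ≅ F.obj (M.opcycles n) := h'.coconePointUniqueUpToIso h
  have he : opcyclesTo (𝟙 L) n = e.hom := by
    refine (cancel_epi (L.pOpcycles n)).1 ((pOpcycles_opcyclesTo _ _).trans ?_)
    refine Eq.trans (id_comp _) ?_
    exact (h'.comp_coconePointUniqueUpToIso_hom h WalkingParallelPair.one).symm
  rw [he]
  infer_instance

variable {G} {G' : D' ⥤ ChainComplex C ℕ} [G'.PreservesZeroMorphisms] [PreservesFiniteLimits G']
  [PreservesFiniteColimits G']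

/-- The morphism of towers induced by a morphism of complexes. -/
@[simps]
def resolutionTowerHom {L : ChainComplex D ℕ} {hL : ∀ n, L.ExactAt (n + 1)}
    {M : ChainComplex D' ℕ} {hM : ∀ n, M.ExactAt (n + 1)}
    (φ : L ⟶ (F.mapHomologicalComplex _).obj M) (τ : F ⋙ G ⟶ G') :
    ExactTower.Hom (resolutionTower G L hL) (resolutionTower G' M hM) where
  k n := G.map (opcyclesTo φ n) ≫ τ.app (M.opcycles n)
  e n := G.map (liftf φ n) ≫ τ.app (M.X n)
  ι_comm n := by
    refine (assoc _ _ _).trans ((congrArg _ (τ.naturality _).symm).trans ?_)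
    refine (assoc _ _ _).symm.trans (Eq.trans (congrArg (· ≫ τ.app (M.X n)) ?_) (assoc _ _ _))
    refine (G.map_comp _ _).symm.trans (Eq.trans (congrArg G.map ?_) (G.map_comp _ _))
    exact opcyclesTo_fromOpcycles φ n
  π_comm n := by
    refine (assoc _ _ _).trans ((congrArg _ (τ.naturality _).symm).trans ?_)
    refine (assoc _ _ _).symm.trans (Eq.trans (congrArg (· ≫ τ.app (M.opcycles n)) ?_)
      (assoc _ _ _))
    refine (G.map_comp _ _).symm.trans (Eq.trans (congrArg G.map ?_) (G.map_comp _ _))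
    exact (pOpcycles_opcyclesTo φ n).symm

/-- The identification of the opcycles of a projective resolution in degree `0`. -/
def augOpcycles {Y : D} (P : ProjectiveResolution Y) : P.complex.opcycles 0 ⟶ Y :=
  P.complex.descOpcycles (P.π.f 0) 1 (by simp) P.complex_d_comp_π_f_zero

lemma pOpcycles_augOpcycles {Y : D} (P : ProjectiveResolution Y) :
    P.complex.pOpcycles 0 ≫ augOpcycles P = P.π.f 0 := P.complex.p_descOpcycles _ _ _ _

instance {Y : D} (P : ProjectiveResolution Y) : IsIso (augOpcycles P) := by
  have h' := P.complex.opcyclesIsCokernel 1 0 (by simp)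
  let e : P.complex.opcycles 0 ≅ Y := h'.coconePointUniqueUpToIso P.isColimitCokernelCofork
  have he : augOpcycles P = e.hom := by
    refine (cancel_epi (P.complex.pOpcycles 0)).1 ((pOpcycles_augOpcycles P).trans ?_)
    exact (h'.comp_coconePointUniqueUpToIso_hom P.isColimitCokernelCofork
      WalkingParallelPair.one).symm
  rw [he]
  infer_instance

end ResolutionTower

/-! ### Comparison maps read on complexes of colimits. -/

section Comparison

variable {A B : Type u} [SmallCategory A] [SmallCategory B]

/-- `H₀` of the Bousfield-Kan complex is the colimit functor. -/
def colimIsoBkHomology (A : Type u) [SmallCategory A] :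
    colimA A ≅ bkFunctor A ⋙ HomologicalComplex.homologyFunctor _ _ 0 :=
  (NatIso.ofComponents (fun X => bkHomologyZeroIso X)
    (fun f => bkHomologyZeroIso_naturality f)).symm

variable (F : A ⥤ B)

/-- The morphism of complexes of colimits induced by a map of resolutions. -/
abbrev colimComplexMap {L : ChainComplex (AbPsh A) ℕ} {M : ChainComplex (AbPsh B) ℕ}
    (φ : L ⟶ ((restr F).mapHomologicalComplex _).obj M) :
    ((colimA A).mapHomologicalComplex _).obj L ⟶ ((colimA B).mapHomologicalComplex _).obj M :=
  ((colimA A).mapHomologicalComplex _).map φ ≫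
    (NatTrans.mapHomologicalComplex (colimRestr F) _).app M

lemma colimMap_bkHomologyZeroIso_inv {X : AbPsh A} {Y : AbPsh B} (f : X ⟶ (restr F).obj Y) :
    (colimA A).map f ≫ (colimRestr F).app Y ≫ (bkHomologyZeroIso Y).inv =
      (bkHomologyZeroIso X).inv ≫ HomologicalComplex.homologyMap
        ((bkFunctor A).map f ≫ (lambdaNat F).app Y) 0 := by
  rw [Iso.eq_inv_comp]
  refine ((reassoc_of% bkHomologyZeroIso_naturality f) _).symm.trans ?_
  refine Eq.trans ?_ (HomologicalComplex.homologyMap_comp _ _ _).symm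
  refine congrArg (HomologicalComplex.homologyMap ((bkFunctor A).map f) 0 ≫ ·) ?_
  refine (assoc _ _ _).symm.trans ?_
  exact (Iso.comp_inv_eq _).2 (bkHomologyZeroIso_lambdaNat F Y).symm

/-- The map on the Bousfield-Kan complexes of the resolved presheaves is a quasi-isomorphism
if and only if the map of complexes of colimits is one. -/
lemma quasiIso_opcycles_iff {L : ChainComplex (AbPsh A) ℕ} (hL : ∀ n, L.ExactAt (n + 1))
    {M : ChainComplex (AbPsh B) ℕ} (hM : ∀ n, M.ExactAt (n + 1))
    (hL' : ∀ i n, ((bkFunctor A).obj (L.X i)).ExactAt (n + 1))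
    (hM' : ∀ i n, ((bkFunctor B).obj (M.X i)).ExactAt (n + 1))
    (φ : L ⟶ ((restr F).mapHomologicalComplex _).obj M) :
    QuasiIso ((bkFunctor A).map (opcyclesTo φ 0) ≫ (lambdaNat F).app (M.opcycles 0)) ↔
      QuasiIso (colimComplexMap F φ) := by
  refine ExactTower.Realization.quasiIso_iff
    (resolutionRealization (colimIsoBkHomology A) L hL)
    (resolutionRealization (colimIsoBkHomology B) M hM)
    (fun i n => (hL' i n).isZero_homology) (fun i n => (hM' i n).isZero_homology)
    (resolutionTowerHom φ (lambdaNat F)) (colimComplexMap F φ) fun n => ?_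
  exact (assoc _ _ _).trans (colimMap_bkHomologyZeroIso_inv F (liftf φ n))

/-- The augmentations identify the degree-zero opcycles with the resolved presheaves, and `hφ` says
that `φ` covers the identity of `F^* X`. -/
lemma quasiIso_lambdaPsh_iff_opcycles {X : AbPsh B} (P : ProjectiveResolution ((restr F).obj X))
    (Q : ProjectiveResolution X) (φ : P.complex ⟶ ((restr F).mapHomologicalComplex _).obj Q.complex)
    (hφ : φ.f 0 ≫ (restr F).map (Q.π.f 0) = P.π.f 0) :
    QuasiIso ((bkFunctor A).map (opcyclesTo φ 0) ≫ (lambdaNat F).app (Q.complex.opcycles 0)) ↔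
      QuasiIso (lambdaPsh F X) := by
  have h : opcyclesTo φ 0 ≫ (restr F).map (augOpcycles Q) = augOpcycles P := by
    refine (cancel_epi (P.complex.pOpcycles 0)).1 ?_
    rw [reassoc_of% pOpcycles_opcyclesTo, ← (restr F).map_comp, pOpcycles_augOpcycles,
      pOpcycles_augOpcycles]
    exact hφ
  refine (HomologicalComplex.quasiIso _ _).arrow_mk_iso_iff (Arrow.isoMk
    ((bkFunctor A).mapIso (asIso (augOpcycles P)))
    ((bkFunctor B).mapIso (asIso (augOpcycles Q))) ?_)
  refine Eq.trans ?_ (assoc _ _ _).symm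
  refine Eq.trans ?_ (congrArg ((bkFunctor A).map (opcyclesTo φ 0) ≫ ·)
    ((lambdaNat F).naturality (augOpcycles Q)))
  refine Eq.trans ?_ (assoc _ _ _)
  refine congrArg (· ≫ lambdaPsh F X) (Eq.trans ?_ ((bkFunctor A).map_comp _ _))
  exact congrArg (bkFunctor A).map h.symm

lemma quasiIso_lambdaPsh_iff {X : AbPsh B} (P : ProjectiveResolution ((restr F).obj X))
    (Q : ProjectiveResolution X) (φ : P.complex ⟶ ((restr F).mapHomologicalComplex _).obj Q.complex)
    (hφ : φ.f 0 ≫ (restr F).map (Q.π.f 0) = P.π.f 0) :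
    QuasiIso (lambdaPsh F X) ↔ QuasiIso (colimComplexMap F φ) := by
  have := P.projective
  have := Q.projective
  rw [← quasiIso_opcycles_iff F P.complex_exactAt_succ Q.complex_exactAt_succ
    (fun i n => exactAt_bk_of_projective _ n) (fun i n => exactAt_bk_of_projective _ n)]
  exact (quasiIso_lambdaPsh_iff_opcycles F P Q φ hφ).symm

/-- If the comparison is a quasi-isomorphism for free presheaves on representable presheaves,
then it always is. -/
lemma quasiIso_lambdaPsh (h : ∀ b, QuasiIso (lambdaPsh F (freeRep B b))) (X : AbPsh B) :
    QuasiIso (lambdaPsh F X) := by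
  let Q := projectiveResolution X
  have := Q.projective
  -- The restricted resolution need not have projective terms. Acyclicity of their Bousfield-Kan
  -- complexes is enough for dimension shifting, so the identity of `L` can replace a lift from a
  -- projective resolution.
  let L := ((restr F).mapHomologicalComplex (ComplexShape.down ℕ)).obj Q.complex
  have hL (n : ℕ) : L.ExactAt (n + 1) := by
    rw [HomologicalComplex.exactAt_iff' _ (n + 2) (n + 1) n (by simp) (by simp)]
    exact (Q.exact_succ n).map (restr F)
  have hc (n : ℕ) : IsIso ((colimRestr F).app (Q.complex.X n)) :=
    isIso_colimRestr_of_projective F (fun b => isIso_colimRestr_of_quasiIso F _ (h b)) _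
  have hq : QuasiIso (colimComplexMap F (𝟙 L)) := by
    have (n : ℕ) : IsIso ((colimComplexMap F (𝟙 L)).f n) := by
      have e : (colimComplexMap F (𝟙 L)).f n = (colimRestr F).app (Q.complex.X n) :=
        (congrArg (· ≫ (colimRestr F).app (Q.complex.X n)) ((colimA A).map_id _)).trans
          (id_comp _)
      rw [e]
      exact hc n
    have := HomologicalComplex.Hom.isIso_of_components (colimComplexMap F (𝟙 L))
    infer_instance
  have hk := (quasiIso_opcycles_iff F hL Q.complex_exactAt_succ
    (fun i n => exactAt_bk_restr_of_projective F _
      (fun b => exactAt_bk_restr_freeRep F b (h b) n) _)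
    (fun i n => exactAt_bk_of_projective _ n) (𝟙 L)).2 hq
  -- The left factor is an isomorphism because restriction commutes with opcycles
  -- (`isIso_opcyclesTo_id`).
  rw [quasiIso_iff_comp_left] at hk
  exact ((HomologicalComplex.quasiIso _ _).arrow_mk_iso_iff (Arrow.isoMk
    ((restr F ⋙ bkFunctor A).mapIso (asIso (augOpcycles Q)))
    ((bkFunctor B).mapIso (asIso (augOpcycles Q)))
    ((lambdaNat F).naturality (augOpcycles Q)))).1 hk

end Comparison

/-! ### The canonical morphism -/

section Lifting

variable {D : Type*} [Category* D] [Abelian D]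

/-- A morphism from a complex of projectives to an exact complex which vanishes on the
augmentation is homotopic to zero. -/
lemma nonempty_homotopy_zero {L M : ChainComplex D ℕ} [∀ n, Projective (L.X n)] {Z : D}
    {q : M.X 0 ⟶ Z} {hq : M.d 1 0 ≫ q = 0} (e0 : (ShortComplex.mk _ _ hq).Exact)
    (e : ∀ n, (ShortComplex.mk _ _ (M.d_comp_d (n + 2) (n + 1) n)).Exact)
    (f : L ⟶ M) (hf : f.f 0 ≫ q = 0) : Nonempty (Homotopy f 0) := by
  let h0 : L.X 0 ⟶ M.X 1 := e0.liftFromProjective (f.f 0) hf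
  have w0 : h0 ≫ M.d 1 0 = f.f 0 := e0.liftFromProjective_comp _ _
  have z1 : (f.f 1 - L.d 1 0 ≫ h0) ≫ M.d 1 0 = 0 := by
    rw [Preadditive.sub_comp, assoc, w0, f.comm, sub_self]
  let h1 : L.X 1 ⟶ M.X 2 := (e 0).liftFromProjective _ z1
  have w1 : h1 ≫ M.d 2 1 = f.f 1 - L.d 1 0 ≫ h0 := (e 0).liftFromProjective_comp _ _
  have z (n : ℕ) (g : L.X n ⟶ M.X (n + 1)) (g' : L.X (n + 1) ⟶ M.X (n + 2))
      (w : f.f (n + 1) = L.d (n + 1) n ≫ g + g' ≫ M.d (n + 2) (n + 1)) :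
      (f.f (n + 2) - L.d (n + 2) (n + 1) ≫ g') ≫ M.d (n + 2) (n + 1) = 0 := by
    rw [Preadditive.sub_comp, f.comm, w, Preadditive.comp_add, assoc, ← assoc,
      HomologicalComplex.d_comp_d, zero_comp, zero_add, sub_self]
  exact ⟨Homotopy.mkInductive _ h0 w0.symm h1 (by rw [w1]; abel)
    fun n p => ⟨(e (n + 1)).liftFromProjective _ (z n p.1 p.2.1 p.2.2), by
      refine Eq.symm ((congrArg (L.d (n + 2) (n + 1) ≫ p.2.1 + ·)
        ((e (n + 1)).liftFromProjective_comp _ (z n p.1 p.2.1 p.2.2))).trans ?_)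
      exact add_sub_cancel _ _⟩⟩

lemma isIso_map_iso_comp_comp_iff {C C' : Type*} [Category* C] [Category* C'] (G : C ⥤ C')
    {X X' Y Y' : C} (a : X ≅ X') (b : Y ≅ Y') (g : X' ⟶ Y') :
    IsIso (G.map (a.hom ≫ g ≫ b.inv)) ↔ IsIso (G.map g) := by
  rw [G.map_comp, G.map_comp, isIso_comp_left_iff, isIso_comp_right_iff]

end Lifting

section Canonical

variable {A B : Type u} [SmallCategory A] [SmallCategory B] (F : A ⥤ B)

/-- Lifts to the restriction of a resolution are unique up to homotopy. -/
lemma nonempty_homotopy_lift {Y : AbPsh A} {X : AbPsh B} (P : ProjectiveResolution Y)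
    (Q : ProjectiveResolution X)
    {φ ψ : P.complex ⟶ ((restr F).mapHomologicalComplex _).obj Q.complex}
    (h : φ.f 0 ≫ (restr F).map (Q.π.f 0) = ψ.f 0 ≫ (restr F).map (Q.π.f 0)) :
    Nonempty (Homotopy φ ψ) := by
  have := P.projective
  obtain ⟨H⟩ := nonempty_homotopy_zero (L := P.complex)
    (M := ((restr F).mapHomologicalComplex (ComplexShape.down ℕ)).obj Q.complex)
    (Q.exact₀.map (restr F)) (fun n => (Q.exact_succ n).map (restr F)) (φ - ψ) (by
      refine (Preadditive.sub_comp _ _ _).trans ?_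
      exact sub_eq_zero.2 h)
  exact ⟨Homotopy.equivSubZero.symm H⟩

/-- The chain map used in the definition of `homologyRestr`. -/
def homologyRestrMap (X : AbPsh B) :
    ((colimA A).mapHomologicalComplex _).obj (projectiveResolution ((restr F).obj X)).complex ⟶
      ((colimA B).mapHomologicalComplex _).obj (projectiveResolution X).complex :=
  colimComplexMap F
    (exists_lift F X (projectiveResolution ((restr F).obj X)) (projectiveResolution X)).choose

/-- The canonical morphism in the homotopy category of complexes. -/
def homologyRestrHomotopy (X : AbPsh B) :
    (colimA A).leftDerivedToHomotopyCategory.obj ((restr F).obj X) ⟶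
      (colimA B).leftDerivedToHomotopyCategory.obj X :=
  ((projectiveResolution ((restr F).obj X)).isoLeftDerivedToHomotopyCategoryObj
    (colimA A)).hom ≫ (HomotopyCategory.quotient _ _).map (homologyRestrMap F X) ≫
      ((projectiveResolution X).isoLeftDerivedToHomotopyCategoryObj (colimA B)).inv

/-- The canonical morphism is an isomorphism if and only if the comparison of Bousfield-Kan
complexes is a quasi-isomorphism. -/
lemma isIso_homologyRestr_iff (X : AbPsh B) :
    IsIso (homologyRestr F X) ↔ QuasiIso (lambdaPsh F X) := by
  rw [quasiIso_lambdaPsh_iff F _ _ _ (exists_lift F X (projectiveResolution ((restr F).obj X))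
    (projectiveResolution X)).choose_spec]
  change _ ↔ QuasiIso (homologyRestrMap F X)
  rw [← HomologicalComplex.mem_quasiIso_iff,
    ← HomologicalComplexUpToQuasiIso.isIso_Q_map_iff_mem_quasiIso]
  -- The outer factors only identify the derived functor with chosen resolutions; what remains is
  -- the image of a chain map, invertible exactly when it is a quasi-isomorphism.
  refine (isIso_map_iso_comp_comp_iff HomologicalComplexUpToQuasiIso.Qh _ _ _).trans ?_
  exact (MorphismProperty.isomorphisms _).arrow_mk_iso_iff
    ((Arrow.isoMk ((HomologicalComplexUpToQuasiIso.quotientCompQhIso _ _).app _)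
      ((HomologicalComplexUpToQuasiIso.quotientCompQhIso _ _).app _)
      ((HomologicalComplexUpToQuasiIso.quotientCompQhIso _ _).hom.naturality _).symm))

/-- The chosen lifts are not natural on the nose. Both routes lift the same morphism of presheaves,
hence are homotopic, and additive functors preserve the homotopy. -/
lemma homologyRestrMap_naturality {X Y : AbPsh B} (f : X ⟶ Y)
    (α : (projectiveResolution ((restr F).obj X)).complex ⟶
      (projectiveResolution ((restr F).obj Y)).complex)
    (hα : α.f 0 ≫ (projectiveResolution ((restr F).obj Y)).π.f 0 =
      (projectiveResolution ((restr F).obj X)).π.f 0 ≫ (restr F).map f)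
    (β : (projectiveResolution X).complex ⟶ (projectiveResolution Y).complex)
    (hβ : β.f 0 ≫ (projectiveResolution Y).π.f 0 = (projectiveResolution X).π.f 0 ≫ f) :
    (HomotopyCategory.quotient _ _).map
      (((colimA A).mapHomologicalComplex _).map α ≫ homologyRestrMap F Y) =
    (HomotopyCategory.quotient _ _).map
      (homologyRestrMap F X ≫ ((colimA B).mapHomologicalComplex _).map β) := by
  have hX := (exists_lift F X (projectiveResolution ((restr F).obj X))
    (projectiveResolution X)).choose_spec
  have hY := (exists_lift F Y (projectiveResolution ((restr F).obj Y))
    (projectiveResolution Y)).choose_spec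
  set φ := (exists_lift F X (projectiveResolution ((restr F).obj X))
    (projectiveResolution X)).choose with hφ
  set ψ := (exists_lift F Y (projectiveResolution ((restr F).obj Y))
    (projectiveResolution Y)).choose with hψ
  obtain ⟨H⟩ := nonempty_homotopy_lift F (projectiveResolution ((restr F).obj X))
    (projectiveResolution Y) (φ := α ≫ ψ)
    (ψ := φ ≫ ((restr F).mapHomologicalComplex _).map β) (by
      refine (assoc _ _ _).trans ((congrArg (α.f 0 ≫ ·) hY).trans (hα.trans ?_))
      refine Eq.symm ((assoc _ _ _).trans ?_)
      refine (congrArg (φ.f 0 ≫ ·) (((restr F).map_comp _ _).symm.trans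
        ((congrArg (restr F).map hβ).trans ((restr F).map_comp _ _)))).trans ?_
      exact (assoc _ _ _).symm.trans (congrArg (· ≫ (restr F).map f) hX))
  have h := HomotopyCategory.eq_of_homotopy _ _ (((colimA A).mapHomotopy H).compRight
    ((NatTrans.mapHomologicalComplex (colimRestr F) _).app (projectiveResolution Y).complex))
  refine Eq.trans ?_ (h.trans ?_)
  · refine congrArg (HomotopyCategory.quotient _ _).map ?_
    refine (assoc _ _ _).symm.trans (congrArg (· ≫ _) ?_)
    exact (Functor.map_comp _ _ _).symm
  · refine congrArg (HomotopyCategory.quotient _ _).map ?_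
    refine (congrArg (· ≫ _) (Functor.map_comp _ _ _)).trans ((assoc _ _ _).trans ?_)
    refine (congrArg (((colimA A).mapHomologicalComplex _).map φ ≫ ·)
      ((NatTrans.mapHomologicalComplex (colimRestr F) _).naturality β)).trans ?_
    exact (assoc _ _ _).symm

lemma homologyRestrHomotopy_naturality {X Y : AbPsh B} (f : X ⟶ Y) :
    (colimA A).leftDerivedToHomotopyCategory.map ((restr F).map f) ≫ homologyRestrHomotopy F Y =
      homologyRestrHomotopy F X ≫ (colimA B).leftDerivedToHomotopyCategory.map f := by
  let P (X : AbPsh B) := projectiveResolution ((restr F).obj X)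
  let Q (X : AbPsh B) := projectiveResolution X
  let α := ProjectiveResolution.lift ((restr F).map f) (P X) (P Y)
  let β := ProjectiveResolution.lift f (Q X) (Q Y)
  have hα : α.f 0 ≫ (P Y).π.f 0 = (P X).π.f 0 ≫ (restr F).map f :=
    ProjectiveResolution.lift_commutes_zero _ _ _
  have hβ : β.f 0 ≫ (Q Y).π.f 0 = (Q X).π.f 0 ≫ f :=
    ProjectiveResolution.lift_commutes_zero _ _ _
  rw [homologyRestrHomotopy, homologyRestrHomotopy]
  refine (ProjectiveResolution.isoLeftDerivedToHomotopyCategoryObj_hom_naturality_assoc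
    _ _ _ _ hα (colimA A) _).trans ?_
  rw [assoc, assoc, ProjectiveResolution.isoLeftDerivedToHomotopyCategoryObj_inv_naturality
    _ _ _ _ hβ (colimA B)]
  refine congrArg (_ ≫ ·) ?_
  refine (assoc _ _ _).symm.trans (Eq.trans (congrArg (· ≫ _) ?_) (assoc _ _ _))
  refine (Functor.map_comp (HomotopyCategory.quotient _ _) _ _).symm.trans ?_
  exact (homologyRestrMap_naturality F f α hα β hβ).trans
    (Functor.map_comp (HomotopyCategory.quotient _ _) _ _)

lemma homologyRestr_naturality {X Y : AbPsh B} (f : X ⟶ Y) :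
    (homologyFun A).map ((restr F).map f) ≫ homologyRestr F Y =
      homologyRestr F X ≫ (homologyFun B).map f := by
  have h := congrArg HomologicalComplexUpToQuasiIso.Qh.map (homologyRestrHomotopy_naturality F f)
  rw [Functor.map_comp, Functor.map_comp] at h
  exact h

/-- The canonical morphisms as a natural transformation. -/
def homologyRestrNat : restr F ⋙ homologyFun A ⟶ homologyFun B where
  app X := homologyRestr F X
  naturality _ _ f := homologyRestr_naturality F f

lemma nonempty_iso_of_quasiIso_lambdaPsh (h : ∀ X, QuasiIso (lambdaPsh F X)) :
    Nonempty (restr F ⋙ homologyFun A ≅ homologyFun B) := by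
  have (X : AbPsh B) : IsIso ((homologyRestrNat F).app X) :=
    (isIso_homologyRestr_iff F X).2 (h X)
  exact ⟨@asIso _ _ _ _ (homologyRestrNat F) (NatIso.isIso_of_isIso_app _)⟩

end Canonical

/-! ### Abstract isomorphisms of homology functors -/

section Abstract

variable {A B : Type u} [SmallCategory A] [SmallCategory B]

/-- The Bousfield-Kan complex computes the homology of a presheaf. -/
lemma nonempty_homologyIso (X : AbPsh A) (n : ℕ) :
    Nonempty ((HomologicalComplexUpToQuasiIso.homologyFunctor _ _ n).obj ((homologyFun A).obj X) ≅
      ((bkFunctor A).obj X).homology n) := by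
  let P := projectiveResolution X
  have := P.projective
  let H := HomologicalComplexUpToQuasiIso.homologyFunctor AddCommGrpCat.{u} (ComplexShape.down ℕ) n
  let L := ((colimA A).mapHomologicalComplex (ComplexShape.down ℕ)).obj P.complex
  let e₁ : H.obj ((homologyFun A).obj X) ≅ L.homology n :=
    H.mapIso (HomologicalComplexUpToQuasiIso.Qh.mapIso
      (P.isoLeftDerivedToHomotopyCategoryObj (colimA A)) ≪≫
      (HomologicalComplexUpToQuasiIso.quotientCompQhIso _ _).app L) ≪≫
      (HomologicalComplexUpToQuasiIso.homologyFunctorFactors _ _ n).app L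
  obtain ⟨e₂, -⟩ := (resolutionRealization (colimIsoBkHomology A) P.complex
    P.complex_exactAt_succ).exists_homologyIso
      (fun i n => (exactAt_bk_of_projective (P.complex.X i) n).isZero_homology) n
  let e₃ : ((bkFunctor A).obj (P.complex.opcycles 0)).homology n ≅
      ((bkFunctor A).obj X).homology n :=
    (bkFunctor A ⋙ HomologicalComplex.homologyFunctor _ _ n).mapIso (asIso (augOpcycles P))
  exact ⟨e₁ ≪≫ e₂.symm ≪≫ e₃⟩

variable (F : A ⥤ B)

lemma nonempty_bkHomologyIso (e : restr F ⋙ homologyFun A ≅ homologyFun B) (X : AbPsh B) (n : ℕ) :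
    Nonempty (((bkFunctor A).obj ((restr F).obj X)).homology n ≅
      ((bkFunctor B).obj X).homology n) := by
  obtain ⟨e₁⟩ := nonempty_homologyIso ((restr F).obj X) n
  obtain ⟨e₂⟩ := nonempty_homologyIso X n
  exact ⟨e₁.symm ≪≫ (HomologicalComplexUpToQuasiIso.homologyFunctor _ _ n).mapIso (e.app X) ≪≫ e₂⟩

/-- Any isomorphism `e`, unrelated to `f`, turns `f` into a surjective endomorphism of a finitely
generated group, which is injective. -/
lemma isIso_of_epi_of_finite {M N : AddCommGrpCat.{u}} (e : N ≅ M) (f : M ⟶ N) [Epi f]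
    [Module.Finite ℤ N] : IsIso f := by
  have hs : Function.Surjective (e.hom ≫ f) := by
    rw [← AddCommGrpCat.epi_iff_surjective]
    infer_instance
  have hi : Function.Injective (e.hom ≫ f) :=
    OrzechProperty.injective_of_surjective_endomorphism (e.hom ≫ f).hom.toIntLinearMap hs
  have : Mono (e.hom ≫ f) := (AddCommGrpCat.mono_iff_injective _).2 hi
  have : IsIso (e.hom ≫ f) := isIso_of_mono_of_epi _
  exact IsIso.of_isIso_comp_left e.hom f

/-- The generator of the colimit of a free presheaf on a representable presheaf. -/
def colimFreeRepGen (b : B) : (colimA B).obj (freeRep B b) :=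
  colimit.ι (freeRep B b) (op b) (freeElem (𝟭 B) b (𝟙 b))

/-- The element `x` is the restriction along `x` of the identity of `b`; hence the colimit is
cyclic. -/
lemma ι_freeElem {b b' : B} (x : b' ⟶ b) :
    colimit.ι (freeRep B b) (op b') (freeElem (𝟭 B) b x) = colimFreeRepGen b := by
  have h := map_freeElem (𝟭 B) b x (𝟙 b)
  have h' := ConcreteCategory.congr_hom (colimit.w (freeRep B b) x.op) (freeElem (𝟭 B) b (𝟙 b))
  refine Eq.trans ?_ h'
  refine Eq.trans ?_ (ConcreteCategory.comp_apply _ _ _).symm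
  refine congrArg _ (Eq.trans ?_ h.symm)
  exact congrArg (freeElem (𝟭 B) b) (comp_id x).symm

lemma colimFreeRep_hom_ext {b : B} {M : AddCommGrpCat.{u}}
    {f g : (colimA B).obj (freeRep B b) ⟶ M} (h : f (colimFreeRepGen b) = g (colimFreeRepGen b)) :
    f = g := by
  apply colimit.hom_ext
  intro b'
  apply freeElem_hom_ext (𝟭 B) b (a := b'.unop)
  intro x
  refine (ConcreteCategory.comp_apply _ _ _).trans
    (Eq.trans ?_ (ConcreteCategory.comp_apply _ _ _).symm)
  have := ι_freeElem x
  exact (congrArg f this).trans (h.trans (congrArg g this).symm)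

instance (b : B) : Module.Finite ℤ ((colimA B).obj (freeRep B b)) := by
  have : Epi (elemHom (colimFreeRepGen b)) := ⟨fun f g h => colimFreeRep_hom_ext (by
    have h' := ConcreteCategory.congr_hom h (ULift.up 1)
    rw [ConcreteCategory.comp_apply, ConcreteCategory.comp_apply, elemHom_one] at h'
    exact h')⟩
  have hs := (AddCommGrpCat.epi_iff_surjective _).1 this
  refine Module.Finite.of_surjective (zmultiplesHom _ (colimFreeRepGen b)).toIntLinearMap ?_
  intro y
  obtain ⟨n, hn⟩ := hs y
  exact ⟨n.down, hn⟩

lemma epi_colimRestr_freeRep {a : A} {b : B} (v : F.obj a ⟶ b) :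
    Epi ((colimRestr F).app (freeRep B b)) := by
  refine ⟨fun f g h => colimFreeRep_hom_ext ?_⟩
  have e : (colimRestr F).app (freeRep B b)
      (colimit.ι ((restr F).obj (freeRep B b)) (op a) (freeElem F b v)) = colimFreeRepGen b := by
    refine Eq.trans ?_ (ι_freeElem v)
    refine (ConcreteCategory.comp_apply _ _ _).symm.trans ?_
    exact ConcreteCategory.congr_hom (colimit.ι_pre (freeRep B b) F.op (op a)) _
  rw [← e]
  refine (ConcreteCategory.comp_apply _ _ _).symm.trans
    (Eq.trans ?_ (ConcreteCategory.comp_apply _ _ _))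
  exact ConcreteCategory.congr_hom h _

lemma isZero_colim_restr_freeRep {b : B} (h : ∀ a, IsEmpty (F.obj a ⟶ b)) :
    IsZero ((colimA A).obj ((restr F).obj (freeRep B b))) := by
  rw [IsZero.iff_id_eq_zero]
  apply colimit.hom_ext
  intro a
  apply freeElem_hom_ext F b (a := a.unop)
  intro x
  exact (h a.unop).elim x

lemma isIso_colimRestr_freeRep (b : B)
    (e : (colimA A).obj ((restr F).obj (freeRep B b)) ≅ (colimA B).obj (freeRep B b)) :
    IsIso ((colimRestr F).app (freeRep B b)) := by
  by_cases h : ∃ a, Nonempty (F.obj a ⟶ b)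
  · obtain ⟨a, ⟨v⟩⟩ := h
    have := epi_colimRestr_freeRep F v
    exact isIso_of_epi_of_finite e.symm _
  -- With no object over `b`, the restricted presheaf vanishes, and `e` forces the target colimit to
  -- vanish too.
  · have h₁ : IsZero ((colimA A).obj ((restr F).obj (freeRep B b))) :=
      isZero_colim_restr_freeRep F fun a => ⟨fun v => h ⟨a, ⟨v⟩⟩⟩
    exact ⟨0, h₁.eq_of_src _ _, (h₁.of_iso e.symm).eq_of_src _ _⟩

lemma quasiIsoAt_zero_of_isIso_colimRestr (X : AbPsh B) (h : IsIso ((colimRestr F).app X)) :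
    QuasiIsoAt (lambdaPsh F X) 0 := by
  rw [quasiIsoAt_iff_isIso_homologyMap]
  have h' := bkHomologyZeroIso_lambdaNat F X
  have : IsIso (HomologicalComplex.homologyMap ((lambdaNat F).app X) 0) :=
    IsIso.of_isIso_fac_right h'
  exact this

/-- An abstract isomorphism of homology functors forces the comparison maps to be
quasi-isomorphisms. -/
lemma quasiIso_lambdaPsh_freeRep_of_iso (e : restr F ⋙ homologyFun A ≅ homologyFun B) (b : B) :
    QuasiIso (lambdaPsh F (freeRep B b)) := by
  rw [quasiIso_iff]
  rintro (_ | n)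
  · obtain ⟨i⟩ := nonempty_bkHomologyIso F e (freeRep B b) 0
    exact quasiIsoAt_zero_of_isIso_colimRestr F _ (isIso_colimRestr_freeRep F b
      ((bkHomologyZeroIso _).symm ≪≫ i ≪≫ bkHomologyZeroIso _))
  -- The target has no homology in positive degrees, so vanishing of the source suffices and any
  -- isomorphism gives it.
  · obtain ⟨i⟩ := nonempty_bkHomologyIso F e (freeRep B b) (n + 1)
    refine (quasiIsoAt_iff_exactAt' _ _ (exactAt_bk_freeRep b n)).2 ?_
    exact (HomologicalComplex.exactAt_iff_isZero_homology _ _).2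
      ((exactAt_bk_freeRep b n).isZero_homology.of_iso i)

lemma isHomologyAspherical_iff :
    IsHomologyAspherical F ↔ ∀ b, QuasiIso (lambdaObj F b) :=
  forall_congr' fun _ => (isIso_homologyRestr_iff _ _).trans (quasiIso_lambdaPsh_constZ_iff _)

end Abstract

end HomAsph

end

/-! ### Equivalence of the four conditions and detection of weak equivalences. -/

theorem mainTheorem8 {A B : Type u} [SmallCategory A] [SmallCategory B] (F : A ⥤ B) :
    List.TFAE [
      HomAsph.IsHomologyAspherical F,
      ∀ b : B, QuasiIso (HomAsph.lambdaObj F b),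
      ∀ X : HomAsph.AbPsh B, QuasiIso (HomAsph.lambdaPsh F X),
      Nonempty (HomAsph.restr F ⋙ HomAsph.homologyFun A ≅ HomAsph.homologyFun B)] ∧
    (HomAsph.IsHomologyAspherical F →
      ∀ ⦃X Y : HomAsph.AbPsh B⦄ (f : X ⟶ Y),
        HomAsph.weakEq B f ↔ HomAsph.weakEq A ((HomAsph.restr F).map f)) := by
  have h₁₂ := HomAsph.isHomologyAspherical_iff F
  have h₂₃ : (∀ b : B, QuasiIso (HomAsph.lambdaObj F b)) →
      ∀ X : HomAsph.AbPsh B, QuasiIso (HomAsph.lambdaPsh F X) := fun h =>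
    HomAsph.quasiIso_lambdaPsh F fun b => (HomAsph.quasiIso_lambdaPsh_freeRep_iff F b).2 (h b)
  have h₃₄ := HomAsph.nonempty_iso_of_quasiIso_lambdaPsh F
  refine ⟨?_, fun h X Y f => ?_⟩
  · tfae_have 1 ↔ 2 := h₁₂
    tfae_have 2 → 3 := h₂₃
    tfae_have 3 → 4 := h₃₄
    tfae_have 4 → 2 := fun ⟨e⟩ b => (HomAsph.quasiIso_lambdaPsh_freeRep_iff F b).1
      (HomAsph.quasiIso_lambdaPsh_freeRep_of_iso F e b)
    tfae_finish
  · obtain ⟨e⟩ := h₃₄ (h₂₃ (h₁₂.1 h))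
    exact (NatIso.isIso_map_iff e f).symm
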